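/- Let $d\ge 1$ and let $Z=(Z(t))_{t\in\mathbb R^d}$ be a random field on a probability space $(\Omega,\mathcal F,\mathbb P)$ whose sample paths are almost surely non-negative and càdlàg (at each $t$ all $2^d$ quadrant limits exist and are finite, and the path is continuous at $t$ from the upper orthant $\{s\ge t\}$). Assume that $\mathbb E[Z(t)]=1$ for all $t\in\mathbb R^d$, that $\mathbb E\big[\sup_{t\in[0,T]^d}Z(t)\big]<\infty$ for all $T>0$, and that $\mathbb P(\sup_{t\in\mathbb R^d}Z(t)>0)=1$. Assume further that $Z$ is a spectral random field of a stationary max-stable random field $X$, i.e. that $$X(t)=\max_{i\ge1}\Gamma_i^{-1}Z^{(i)}(t),\qquad t\in\mathbb R^d,$$ is stationary, where $\Gamma_i=\sum_{k=1}^i\mathcal V_k$, the $\mathcal V_k$ are independent unit exponential random variables, and $(Z^{(i)})_{i\ge1}$ are independent copies of $Z$, independent of $(\mathcal V_k)_{k\ge1}$. For $\delta>0$ let $\lambda_\delta$ be $\delta^d$ times the counting measure on $\delta\mathbb Z^d$; let $\lambda_0=\lambda$ be Lebesgue measure on $\mathbb R^d$ and put $0\,\mathbb Z^d:=\mathbb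 R^d$. For $\delta,x\ge0$ define $$\mathcal B_Z^\delta(x)=\lim_{T\to\infty}\frac1{T^d}\int_0^\infty\mathbb P\Big(\int_{[0,T]^d\cap\delta\mathbb Z^d}\mathbb I(Z(t)>s)\,\lambda_\delta(dt)>x\Big)ds ,$$ and let $S_0=\int_{\mathbb R^d}Z(t)\,\lambda(dt)$. Let $\Theta$ be a random field with almost surely non-negative càdlàg paths and with law $\mu(A)=\mathbb E\big[Z(0)\,\mathbb I(Z/Z(0)\in A)\big]$, let $R$ be a random variable independent of $\Theta$ with $\mathbb P(R>r)=1/r$ for $r\ge1$, and set $$Y(t)=R\,\Theta(t),\qquad \epsilon_\delta(Y)=\int_{\delta\mathbb Z^d}\mathbb I(Y(t)>1)\,\lambda_\delta(dt).$$ Theorem. If $\mathbb P(S_0=\infty)<1$, then for all $\delta,x\ge0$ the limit defining $\mathcal B_Z^\delta(x)$ exists and $$\mathcal B_Z^\delta(x)=\mathbb E\left[\frac{\mathbb I(\epsilon_\delta(Y)>x)}{\epsilon_\delta(Y)}\right]<\infty ,$$ where the quotient is read as $0$ when $\epsilon_\delta(Y)=\infty$ or when its numerator is $0$. -/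

import Mathlib

open MeasureTheory ProbabilityTheory Filter Topology Set
open scoped ENNReal

namespace Berman

noncomputable section

/-- A function on `ℝ^d` is (generalised) càdlàg: it is continuous from the upper orthant at every
point, and at every point `t` it has a finite limit along each of the `2^d` quadrants
`{s | s_i ≥ t_i for i ∈ I, s_i < t_i for i ∉ I}`. -/
def IsCadlag {d : ℕ} (f : (Fin d → ℝ) → ℝ) : Prop :=
  ∀ t : Fin d → ℝ, ContinuousWithinAt f (Ici t) t ∧
    ∀ I : Set (Fin d), ∃ l : ℝ,
      Tendsto f (𝓝[{s | ∀ i, (i ∈ I → t i ≤ s i) ∧ (i ∉ I → s i < t i)}] t) (𝓝 l)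

/-- The space `D` of non-negative càdlàg functions on `ℝ^d`. Its σ-field, generated by the
projections `f ↦ f t`, is the trace of the product σ-field on `(Fin d → ℝ) → ℝ`. -/
def cadlagSpace (d : ℕ) : Set ((Fin d → ℝ) → ℝ) :=
  {f | (∀ t, 0 ≤ f t) ∧ IsCadlag f}

/-- The lattice `δℤ^d`. -/
def lattice (d : ℕ) (δ : ℝ) : Set (Fin d → ℝ) :=
  {t | ∀ i, ∃ k : ℤ, t i = δ * k}

/-- `λ_δ`: Lebesgue measure on `ℝ^d` for `δ = 0`, and `δ^d` times the counting measure on `δℤ^d`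
for `δ > 0`. -/
def latticeMeasure (d : ℕ) (δ : ℝ) : Measure (Fin d → ℝ) :=
  if δ = 0 then volume else ENNReal.ofReal (δ ^ d) • Measure.count.restrict (lattice d δ)

/-- The sojourn `∫_{A ∩ δℤ^d} 𝟙(f(t) > s) λ_δ(dt)` of `f` above the level `s` in the set `A`
(with `0ℤ^d = ℝ^d`; note that `λ_δ` is carried by `δℤ^d`). -/
def sojourn {d : ℕ} (δ : ℝ) (A : Set (Fin d → ℝ)) (s : ℝ) (f : (Fin d → ℝ) → ℝ) : ℝ≥0∞ :=
  latticeMeasure d δ {t ∈ A | s < f t}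

/-- `S_δ(f) = ∫_{δℤ^d} f(t) λ_δ(dt)` for a non-negative function `f`. -/
def totalMass {d : ℕ} (δ : ℝ) (f : (Fin d → ℝ) → ℝ) : ℝ≥0∞ :=
  ∫⁻ t, ENNReal.ofReal (f t) ∂(latticeMeasure d δ)

/-- The Berman function of the box `[0,T]^d ∩ δℤ^d`:
`∫_0^∞ P(∫_{[0,T]^d ∩ δℤ^d} 𝟙(Z(t) > s) λ_δ(dt) > x) ds`. -/
def bermanBox {d : ℕ} {Ω : Type*} [MeasurableSpace Ω] (P : Measure Ω)
    (Z : Ω → (Fin d → ℝ) → ℝ) (δ x T : ℝ) : ℝ≥0∞ :=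
  ∫⁻ s in Ioi (0 : ℝ),
    P {ω | ENNReal.ofReal x < sojourn δ (Icc 0 (fun _ => T)) s (Z ω)}

/-- `B_Z^δ(x)` exists and equals `b`, where
`B_Z^δ(x) = lim_{T → ∞} T^{-d} B_Z^δ([0,T]^d ∩ δℤ^d, x)`. -/
def HasBermanValue {d : ℕ} {Ω : Type*} [MeasurableSpace Ω] (P : Measure Ω)
    (Z : Ω → (Fin d → ℝ) → ℝ) (δ x : ℝ) (b : ℝ≥0∞) : Prop :=
  Tendsto (fun T : ℝ => bermanBox P Z δ x T / ENNReal.ofReal (T ^ d)) atTop (𝓝 b)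

/-- `Z` is a spectral random field of `X`: almost surely, for each `t`,
`X(t) = max_i Γ_i⁻¹ Z^(i)(t)`, where `Γ_i = V_0 + ⋯ + V_i` with `V_k` independent unit exponential
variables that are independent of the sequence `Z^(i)` of independent copies of `Z`.
(The supremum is almost surely finite and attained when `Z(t) ≥ 0` is integrable.) -/
def IsSpectralField {d : ℕ} {Ω Ω' : Type*} [MeasurableSpace Ω] [MeasurableSpace Ω']
    (P : Measure Ω) (Z : Ω → (Fin d → ℝ) → ℝ)
    (P' : Measure Ω') (X : Ω' → (Fin d → ℝ) → ℝ) : Prop :=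
  ∃ (V : ℕ → Ω' → ℝ) (W : ℕ → Ω' → (Fin d → ℝ) → ℝ),
    (∀ k, Measurable (V k)) ∧ (∀ k, P'.map (V k) = expMeasure 1) ∧ iIndepFun V P' ∧
    (∀ k, Measurable (W k)) ∧ (∀ k, IdentDistrib (W k) Z P' P) ∧ iIndepFun W P' ∧
    IndepFun (fun ω k => V k ω) (fun ω k => W k ω) P' ∧
    ∀ t, ∀ᵐ ω ∂P', X ω t = ⨆ i : ℕ, (∑ k ∈ Finset.range (i + 1), V k ω)⁻¹ * W i ω t

/-- The random field `X` is (strictly) stationary: its finite-dimensional distributions are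
invariant under shifts of the parameter. -/
def IsStationaryField {d : ℕ} {Ω : Type*} [MeasurableSpace Ω] (P : Measure Ω)
    (X : Ω → (Fin d → ℝ) → ℝ) : Prop :=
  ∀ h : Fin d → ℝ, IdentDistrib (fun ω t => X ω (t + h)) X P P

/-- The tilted law `μ(A) = E[Z(0) 𝟙(Z / Z(0) ∈ A)]`. -/
def tiltedLaw {d : ℕ} {Ω : Type*} [MeasurableSpace Ω] (P : Measure Ω)
    (Z : Ω → (Fin d → ℝ) → ℝ) : Measure ((Fin d → ℝ) → ℝ) :=
  (P.withDensity (fun ω => ENNReal.ofReal (Z ω 0))).map (fun ω t => Z ω t / Z ω 0)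

end

end Berman

namespace Berman

/-! Let ν be `exponentMeasure P Z` and let E_A(f) be the λ_δ-measure of {t ∈ A : f(t) > 1}. Both
sides of the claim are quantities of ν: the Berman function of a box A is ν{E_A > x}
(`bermanBox_eq`), and Y = RΘ has law ν restricted to {f(0) > 1} (`map_pareto_mul_tilted`).

The finite-dimensional distributions of X are exponentials of minus ν-masses
(`measure_forall_le_eq_exp`). Stationarity of X therefore says that translating Z does not change ν
on {f(0) > 1} (`restrict_exponentMeasure_shift`).

With ψ(l) = 𝟙(l > x)/l, write 𝟙(E_A > x) = ψ(E_A) E_A and expand the factor E_A as an integral over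
t ∈ A of 𝟙(f(t) > 1). Fubini and translation by t give ν{E_A > x} = ∫_A ∫_{f(0) > 1} ψ(E_{A-t}) dν
λ_δ(dt) (`lintegral_excursion_mul`). For most t in a large box A the set A - t nearly fills the
space, so the average over A tends to ∫_{f(0) > 1} ψ(E_{ℝ^d}) dν = E ψ(ε_δ(Y)).

For x > 0 the bound ψ ≤ 1/x justifies the limit (`tendsto_average_truncInv`). For x = 0 and δ > 0, a
non-zero E_A is at least δ^d, so 0 may be replaced by δ^d/2. For x = 0 = δ, short excursions are
controlled by a covering with unit cubes, where the moment of the supremum of Z gives finite mass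
(`tendsto_exponentMeasure_excursion_pos`). -/

theorem lintegral_expMeasure_one (f : ℝ → ℝ≥0∞) (hf : Measurable f) :
    ∫⁻ v, f v ∂(expMeasure 1) = ∫⁻ v in Ioi (0 : ℝ), ENNReal.ofReal (Real.exp (-v)) * f v := by
  have hm : Measurable (gammaPDF 1 1) := (measurable_gammaPDFReal 1 1).ennreal_ofReal
  rw [expMeasure, gammaMeasure, lintegral_withDensity_eq_lintegral_mul _ hm hf,
    ← lintegral_indicator measurableSet_Ioi]
  refine lintegral_congr_ae ?_
  have h0 : ∀ᵐ v : ℝ, v ≠ 0 := by simp [ae_iff]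
  filter_upwards [h0] with v hv
  by_cases h : 0 < v
  · rw [indicator_of_mem (show v ∈ Ioi (0 : ℝ) from h), Pi.mul_apply, gammaPDF_of_nonneg h.le]
    simp
  · rw [indicator_of_notMem (show v ∉ Ioi (0 : ℝ) from h), Pi.mul_apply,
      gammaPDF_of_neg (lt_of_le_of_ne (not_lt.1 h) hv), zero_mul]

/-- `exp (-∫_w^∞ g)` for a function `g` that is integrable on `(0, ∞)`. -/
noncomputable def survival (g : ℝ → ℝ) (w : ℝ) : ℝ :=
  Real.exp ((∫ y in (0 : ℝ)..w, g y) - ∫ y in Ioi (0 : ℝ), g y)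

/-! ### The function exp(-∫_w^∞ g) and its one-step identity under an exponential jump -/

section survival

variable {g : ℝ → ℝ}

theorem survival_pos (w : ℝ) : 0 < survival g w := Real.exp_pos _

theorem survival_zero : survival g 0 = Real.exp (-∫ y in Ioi (0 : ℝ), g y) := by
  simp [survival]

theorem survival_le_one (h0 : ∀ y, 0 ≤ g y) (hi : IntegrableOn g (Ioi 0)) {w : ℝ} (hw : 0 ≤ w) :
    survival g w ≤ 1 := by
  rw [survival, Real.exp_le_one_iff, sub_nonpos, intervalIntegral.integral_of_le hw]
  exact setIntegral_mono_set hi (ae_of_all _ h0) (Ioc_subset_Ioi_self.eventuallyLE)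

theorem tendsto_survival (hi : IntegrableOn g (Ioi 0)) :
    Tendsto (survival g) atTop (𝓝 1) := by
  have h := intervalIntegral_tendsto_integral_Ioi (μ := volume) 0 hi tendsto_id
  have h2 := (Real.continuous_exp.tendsto _).comp (h.sub_const (∫ y in Ioi (0 : ℝ), g y))
  simp only [Function.comp_def, id, sub_self, Real.exp_zero] at h2
  exact h2

theorem continuous_survival (hg : Antitone g) : Continuous (survival g) :=
  Real.continuous_exp.comp ((intervalIntegral.continuous_primitive
    (fun _ _ => hg.intervalIntegrable) 0).sub continuous_const)

theorem hasDerivAt_survival (hg : Antitone g) {w : ℝ} (hw : ContinuousAt g w) :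
    HasDerivAt (survival g) (survival g w * g w) w :=
  ((intervalIntegral.integral_hasDerivAt_right (hg.intervalIntegrable)
    hg.measurable.stronglyMeasurable.stronglyMeasurableAtFilter hw).sub_const _).exp

/-- With S = `survival g`, the function -exp(-v) S(u + v) is an antiderivative of the integrand
wherever g is continuous at u + v. An antitone g has only countably many jumps, so the fundamental
theorem of calculus still applies. -/
theorem integral_exp_neg_mul_survival (hg : Antitone g) (h0 : ∀ y, 0 ≤ g y) (h1 : ∀ y, g y ≤ 1)
    (hi : IntegrableOn g (Ioi 0)) {u : ℝ} (hu : 0 ≤ u) :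
    IntegrableOn (fun v => Real.exp (-v) * ((1 - g (u + v)) * survival g (u + v))) (Ioi 0) ∧
    ∫ v in Ioi (0 : ℝ), Real.exp (-v) * ((1 - g (u + v)) * survival g (u + v)) = survival g u := by
  set f := fun v => Real.exp (-v) * ((1 - g (u + v)) * survival g (u + v)) with hf
  have hfm : Measurable f := by
    have h1 : Measurable fun v => g (u + v) := hg.measurable.comp (by fun_prop)
    have h2 : Measurable fun v => survival g (u + v) :=
      (continuous_survival hg).measurable.comp (by fun_prop)
    exact (by fun_prop : Measurable fun v : ℝ => Real.exp (-v)).mul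
      ((measurable_const.sub h1).mul h2)
  have hint : IntegrableOn f (Ioi 0) := by
    refine Integrable.mono' (integrableOn_exp_neg_Ioi 0) hfm.aestronglyMeasurable ?_
    refine (ae_restrict_mem measurableSet_Ioi).mono fun v hv => ?_
    have hv : (0 : ℝ) < v := hv
    have a1 := survival_le_one h0 hi (add_nonneg hu hv.le)
    have a2 := survival_pos (g := g) (u + v)
    have a3 := h0 (u + v)
    have a4 := h1 (u + v)
    rw [hf, Real.norm_of_nonneg (by have := Real.exp_pos (-v); have := sub_nonneg.2 a4; positivity)]
    refine mul_le_of_le_one_right (Real.exp_pos _).le ?_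
    nlinarith
  refine ⟨hint, ?_⟩
  have hfin : ∀ b : ℝ, 0 ≤ b →
      ∫ v in (0 : ℝ)..b, f v = survival g u - Real.exp (-b) * survival g (u + b) := by
    intro b hb
    have hc : Countable ({v | ¬ ContinuousAt g (u + v)} : Set ℝ) := by
      have := hg.countable_not_continuousAt
      exact (this.preimage (f := fun v : ℝ => u + v) (add_right_injective u)).to_subtype
    have := integral_eq_of_hasDerivAt_off_countable
      (fun v => -(Real.exp (-v) * survival g (u + v))) f (a := 0) (b := b) hc ?_ ?_ ?_
    · rw [this]; simp; ring
    · exact (((Real.continuous_exp.comp continuous_neg).mul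
        ((continuous_survival hg).comp (continuous_const.add continuous_id))).neg).continuousOn
    · intro v hv
      have hv2 : ContinuousAt g (u + v) := by simpa using hv.2
      have d1 : HasDerivAt (fun v : ℝ => Real.exp (-v)) (Real.exp (-v) * (-1)) v :=
        (hasDerivAt_neg v).exp
      have d2 := (hasDerivAt_survival hg hv2).comp_const_add u v
      have := (d1.mul d2).neg
      refine this.congr_deriv ?_
      simp only [hf]; ring
    · rw [intervalIntegrable_iff_integrableOn_Ioc_of_le hb]
      exact hint.mono_set Ioc_subset_Ioi_self
  have hl := intervalIntegral_tendsto_integral_Ioi (μ := volume) 0 hint tendsto_id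
  refine tendsto_nhds_unique hl ?_
  have h2 : Tendsto (fun b : ℝ => survival g u - Real.exp (-b) * survival g (u + b)) atTop
      (𝓝 (survival g u - 0 * 1)) :=
    tendsto_const_nhds.sub ((Real.tendsto_exp_neg_atTop_nhds_zero).mul
      ((tendsto_survival hi).comp (tendsto_atTop_add_const_left _ u tendsto_id)))
  simp only [zero_mul, sub_zero] at h2
  refine h2.congr' ?_
  filter_upwards [eventually_ge_atTop (0 : ℝ)] with b hb
  exact (hfin b hb).symm

theorem lintegral_survival (hg : Antitone g) (h0 : ∀ y, 0 ≤ g y) (h1 : ∀ y, g y ≤ 1)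
    (hi : IntegrableOn g (Ioi 0)) {u : ℝ} (hu : 0 ≤ u) :
    ∫⁻ v, ENNReal.ofReal (1 - g (u + v)) * ENNReal.ofReal (survival g (u + v)) ∂(expMeasure 1)
      = ENNReal.ofReal (survival g u) := by
  obtain ⟨a, b⟩ := integral_exp_neg_mul_survival hg h0 h1 hi hu
  have m1 : Measurable fun v => g (u + v) := hg.measurable.comp (by fun_prop)
  have m2 : Measurable fun v => survival g (u + v) :=
    (continuous_survival hg).measurable.comp (by fun_prop)
  have m3 : Measurable fun v => ENNReal.ofReal (1 - g (u + v)) * ENNReal.ofReal (survival g (u + v)) :=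
    (measurable_const.sub m1).ennreal_ofReal.mul m2.ennreal_ofReal
  rw [lintegral_expMeasure_one _ m3, ← b, ofReal_integral_eq_lintegral_ofReal a]
  · refine lintegral_congr fun v => ?_
    rw [ENNReal.ofReal_mul (Real.exp_pos _).le, ENNReal.ofReal_mul (sub_nonneg.2 (h1 _))]
  · refine ae_of_all _ fun v => ?_
    have := sub_nonneg.2 (h1 (u + v))
    have := survival_pos (g := g) (u + v)
    have := Real.exp_pos (-v)
    simp only [Pi.zero_apply]; positivity

end survival

theorem lintegral_exp_neg_expMeasure :
    ∫⁻ v, ENNReal.ofReal (Real.exp (-v)) ∂(expMeasure 1) = 2⁻¹ := by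
  rw [lintegral_expMeasure_one _ (by fun_prop)]
  have : ∀ v : ℝ, ENNReal.ofReal (Real.exp (-v)) * ENNReal.ofReal (Real.exp (-v))
      = ENNReal.ofReal (Real.exp (-2 * v)) := fun v => by
    rw [← ENNReal.ofReal_mul (Real.exp_pos _).le, ← Real.exp_add]; ring_nf
  simp_rw [this]
  have hI : IntegrableOn (fun v : ℝ => Real.exp (-2 * v)) (Ioi 0) :=
    integrableOn_exp_mul_Ioi (by norm_num) 0
  rw [← ofReal_integral_eq_lintegral_ofReal hI (ae_of_all _ fun v => (Real.exp_pos _).le),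
    integral_exp_mul_Ioi (by norm_num)]
  rw [mul_zero, Real.exp_zero, show (-1 : ℝ) / -2 = 2⁻¹ by norm_num,
    ENNReal.ofReal_inv_of_pos (by norm_num)]
  simp

theorem lintegral_indepFun {Ω α β : Type*} [MeasurableSpace Ω] [MeasurableSpace α]
    [MeasurableSpace β] {P : Measure Ω} [IsFiniteMeasure P] {X : Ω → α} {Y : Ω → β}
    (hX : Measurable X) (hY : Measurable Y) (h : IndepFun X Y P) {F : α × β → ℝ≥0∞}
    (hF : Measurable F) :
    ∫⁻ ω, F (X ω, Y ω) ∂P = ∫⁻ ω, ∫⁻ y, F (X ω, y) ∂(P.map Y) ∂P := by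
  have h' := (indepFun_iff_map_prod_eq_prod_map_map hX.aemeasurable hY.aemeasurable).1 h
  rw [← lintegral_map hF (hX.prodMk hY), h', lintegral_prod _ hF.aemeasurable,
    lintegral_map hF.lintegral_prod_right' hX]

/-! ### Laplace functional of the unit-rate Poisson arrivals -/

section arrivals

variable {Ω : Type*} [MeasurableSpace Ω] {P : Measure Ω} [IsProbabilityMeasure P]
  {V : ℕ → Ω → ℝ}

/-- The last waiting time is independent of the earlier ones and can be integrated out first. -/
theorem lintegral_arrivals_succ (hVm : ∀ k, Measurable (V k))
    (hV : ∀ k, P.map (V k) = expMeasure 1) (hi : iIndepFun V P) {G φ : ℝ → ℝ≥0∞}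
    (hG : Measurable G) (hφ : Measurable φ) (n : ℕ) :
    ∫⁻ ω, (∏ i ∈ Finset.range (n + 1), G (∑ k ∈ Finset.range (i + 1), V k ω)) *
        φ (∑ k ∈ Finset.range (n + 1), V k ω) ∂P
      = ∫⁻ ω, (∏ i ∈ Finset.range n, G (∑ k ∈ Finset.range (i + 1), V k ω)) *
        (∫⁻ v, G ((∑ k ∈ Finset.range n, V k ω) + v) * φ ((∑ k ∈ Finset.range n, V k ω) + v)
          ∂(expMeasure 1)) ∂P := by
  -- Partial sums as functions of the first n waiting times alone; the padding value 0 is never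
  -- reached, since only i ≤ n is used.
  let s : ℕ → (Finset.range n → ℝ) → ℝ := fun i a =>
    ∑ k ∈ Finset.range i, if h : k ∈ Finset.range n then a ⟨k, h⟩ else 0
  have hs : ∀ i, Measurable (s i) := fun i => by
    refine Finset.measurable_sum _ fun k _ => ?_
    split_ifs with h
    · exact measurable_pi_apply _
    · exact measurable_const
  have hS : ∀ i, i ≤ n → ∀ ω, s i (fun k => V k ω) = ∑ k ∈ Finset.range i, V k ω := by
    intro i hin ω
    refine Finset.sum_congr rfl fun k hk => ?_
    rw [dif_pos (Finset.mem_range.2 ((Finset.mem_range.1 hk).trans_le hin))]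
  have hind : IndepFun (fun ω (k : Finset.range n) => V k ω) (V n) P := by
    have := hi.indepFun_finset (Finset.range n) {n} (by simp) hVm
    have hn : Measurable fun a : ({n} : Finset ℕ) → ℝ => a ⟨n, by simp⟩ := measurable_pi_apply _
    exact this.comp (φ := id) measurable_id hn
  let F : (Finset.range n → ℝ) × ℝ → ℝ≥0∞ := fun p =>
    (∏ i ∈ Finset.range n, G (s (i + 1) p.1)) * (G (s n p.1 + p.2) * φ (s n p.1 + p.2))
  have hF : Measurable F := by
    have h1 : ∀ i, Measurable fun p : (Finset.range n → ℝ) × ℝ => s i p.1 :=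
      fun i => (hs i).comp measurable_fst
    have h2 : Measurable fun p : (Finset.range n → ℝ) × ℝ => s n p.1 + p.2 :=
      (h1 n).add measurable_snd
    exact (Finset.measurable_prod _ fun i _ => hG.comp (h1 _)).mul
      ((hG.comp h2).mul (hφ.comp h2))
  have key := lintegral_indepFun (measurable_pi_lambda _ fun k : Finset.range n => hVm k) (hVm n) hind hF
  have e1 : ∀ ω, ∏ i ∈ Finset.range n, G (s (i + 1) (fun k => V k ω))
      = ∏ i ∈ Finset.range n, G (∑ k ∈ Finset.range (i + 1), V k ω) := fun ω =>
    Finset.prod_congr rfl fun i hi => by rw [hS _ (Finset.mem_range.1 hi)]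
  simp only [F, e1, hS n le_rfl, hV n] at key
  rw [lintegral_congr fun ω => ?_, key, lintegral_congr fun ω => ?_]
  · rw [lintegral_const_mul]
    exact (hG.comp (measurable_const.add measurable_id)).mul
      (hφ.comp (measurable_const.add measurable_id))
  · rw [Finset.prod_range_succ, Finset.sum_range_succ, mul_assoc]

omit [IsProbabilityMeasure P] in
theorem ae_pos_of_map_expMeasure (hVm : ∀ k, Measurable (V k))
    (hV : ∀ k, P.map (V k) = expMeasure 1) : ∀ᵐ ω ∂P, ∀ k, 0 < V k ω := by
  refine ae_all_iff.2 fun k => ?_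
  have h : ∀ᵐ v ∂(expMeasure 1), (0 : ℝ) < v := by
    have hms : MeasurableSet {a : ℝ | ¬0 < a} :=
      (measurableSet_lt measurable_const measurable_id).compl
    rw [ae_iff, ← lintegral_indicator_one hms,
      lintegral_expMeasure_one _ (measurable_one.indicator hms)]
    rw [setLIntegral_congr_fun measurableSet_Ioi (g := fun _ => 0)]
    · simp
    · intro v hv
      have hv : (0 : ℝ) < v := hv
      simp [hv]
  rw [← hV k] at h
  exact ae_of_ae_map (hVm k).aemeasurable h

theorem lintegral_exp_neg_arrivals (hVm : ∀ k, Measurable (V k))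
    (hV : ∀ k, P.map (V k) = expMeasure 1) (hi : iIndepFun V P) (n : ℕ) :
    ∫⁻ ω, ENNReal.ofReal (Real.exp (-∑ k ∈ Finset.range n, V k ω)) ∂P = 2⁻¹ ^ n := by
  induction n with
  | zero => simp
  | succ n ih =>
    have := lintegral_arrivals_succ hVm hV hi (G := fun _ => 1)
      (φ := fun v => ENNReal.ofReal (Real.exp (-v))) measurable_const (by fun_prop) n
    simp only [Finset.prod_const_one, one_mul] at this
    rw [this, pow_succ, ← ih, ← lintegral_mul_const _ (by fun_prop)]
    refine lintegral_congr fun ω => ?_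
    rw [← lintegral_exp_neg_expMeasure, ← lintegral_const_mul _ (by fun_prop)]
    refine lintegral_congr fun v => ?_
    rw [neg_add, Real.exp_add, ENNReal.ofReal_mul (Real.exp_pos _).le]

/-- With Γ_n the n-th arrival, the products ∏(1 - g(Γ_i)) · S(Γ_n) form a martingale, by
`lintegral_survival`. -/
theorem lintegral_arrivals_survival (hVm : ∀ k, Measurable (V k))
    (hV : ∀ k, P.map (V k) = expMeasure 1) (hi : iIndepFun V P) {g : ℝ → ℝ}
    (hg : Antitone g) (h0 : ∀ y, 0 ≤ g y) (h1 : ∀ y, g y ≤ 1)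
    (hgi : IntegrableOn g (Ioi 0)) (n : ℕ) :
    ∫⁻ ω, (∏ i ∈ Finset.range n, ENNReal.ofReal (1 - g (∑ k ∈ Finset.range (i + 1), V k ω))) *
        ENNReal.ofReal (survival g (∑ k ∈ Finset.range n, V k ω)) ∂P
      = ENNReal.ofReal (survival g 0) := by
  induction n with
  | zero => simp
  | succ n ih =>
    have mg := hg.measurable
    have ms := (continuous_survival hg).measurable
    rw [lintegral_arrivals_succ hVm hV hi (G := fun y => ENNReal.ofReal (1 - g y))
      (φ := fun y => ENNReal.ofReal (survival g y)) (by fun_prop) (by fun_prop) n, ← ih]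
    refine lintegral_congr_ae ?_
    filter_upwards [ae_pos_of_map_expMeasure hVm hV] with ω hω
    rw [lintegral_survival hg h0 h1 hgi (Finset.sum_nonneg fun k _ => (hω k).le)]

/-- The factor S(Γ_n) of the martingale tends to 1 and can be dropped in the limit. -/
theorem tendsto_lintegral_arrivals (hVm : ∀ k, Measurable (V k))
    (hV : ∀ k, P.map (V k) = expMeasure 1) (hi : iIndepFun V P) {g : ℝ → ℝ}
    (hg : Antitone g) (h0 : ∀ y, 0 ≤ g y) (h1 : ∀ y, g y ≤ 1)
    (hgi : IntegrableOn g (Ioi 0)) :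
    Tendsto (fun n => ∫⁻ ω, (∏ i ∈ Finset.range n,
        ENNReal.ofReal (1 - g (∑ k ∈ Finset.range (i + 1), V k ω))) ∂P) atTop
      (𝓝 (ENNReal.ofReal (survival g 0))) := by
  have mg := hg.measurable
  have ms := (continuous_survival hg).measurable
  have hpos := ae_pos_of_map_expMeasure hVm hV
  have hle1 : ∀ (n : ℕ) (ω : Ω), (∏ i ∈ Finset.range n,
      ENNReal.ofReal (1 - g (∑ k ∈ Finset.range (i + 1), V k ω))) ≤ 1 := fun n ω =>
    Finset.prod_le_one' fun i _ => by
      rw [← ENNReal.ofReal_one]; exact ENNReal.ofReal_le_ofReal (by linarith [h0 (∑ k ∈ Finset.range (i + 1), V k ω)])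
  refine ENNReal.tendsto_nhds ENNReal.ofReal_ne_top |>.2 fun ε hε => ?_
  obtain ⟨e, he, hee⟩ : ∃ e : ℝ, 0 < e ∧ ENNReal.ofReal e ≤ ε / 2 := by
    by_cases ht : ε = ∞
    · exact ⟨1, one_pos, by simp [ht, ENNReal.top_div]⟩
    · refine ⟨(ε / 2).toReal, ENNReal.toReal_pos (ENNReal.half_pos hε.ne').ne'
        (ENNReal.div_ne_top ht (by simp)), ENNReal.ofReal_toReal_le⟩
  obtain ⟨Y, hY⟩ := eventually_atTop.1
    ((tendsto_survival hgi).eventually (lt_mem_nhds (show 1 - e < 1 by linarith)))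
  -- Beyond Y the survival term falls short of 1 by at most e; below Y the product of exponentials
  -- is at least 1. Since E exp(-Γ_n) = 2^(-n), the correction vanishes without a law of large
  -- numbers.
  have hbd : ∀ y : ℝ, 0 ≤ y → (1 : ℝ≥0∞) ≤ ENNReal.ofReal (survival g y) +
      (ENNReal.ofReal e + ENNReal.ofReal (Real.exp Y) * ENNReal.ofReal (Real.exp (-y))) := by
    intro y hy
    rw [← ENNReal.ofReal_mul (Real.exp_pos _).le, ← ENNReal.ofReal_add he.le (by positivity),
      ← ENNReal.ofReal_add (survival_pos _).le (by positivity), ← ENNReal.ofReal_one]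
    refine ENNReal.ofReal_le_ofReal ?_
    have a := survival_pos (g := g) y
    by_cases h : Y ≤ y
    · have := hY y h
      have : 0 < Real.exp Y * Real.exp (-y) := by positivity
      linarith
    · rw [← Real.exp_add]
      have : 1 ≤ Real.exp (Y + -y) := Real.one_le_exp (by linarith [not_le.1 h])
      linarith
  have hlim : Tendsto (fun n : ℕ => ENNReal.ofReal (Real.exp Y) * (2⁻¹ : ℝ≥0∞) ^ n) atTop (𝓝 0) := by
    have := ENNReal.Tendsto.const_mul (a := ENNReal.ofReal (Real.exp Y))
      (ENNReal.tendsto_pow_atTop_nhds_zero_of_lt_one (r := 2⁻¹) (by simp))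
      (Or.inr ENNReal.ofReal_ne_top)
    simpa using this
  filter_upwards [(ENNReal.tendsto_nhds_zero.1 hlim) (ε / 2) (ENNReal.half_pos hε.ne')] with n hn
  have hS := lintegral_arrivals_survival hVm hV hi hg h0 h1 hgi n
  set Pr : Ω → ℝ≥0∞ := fun ω => ∏ i ∈ Finset.range n,
    ENNReal.ofReal (1 - g (∑ k ∈ Finset.range (i + 1), V k ω))
  have hPm : Measurable Pr := by
    refine Finset.measurable_prod _ fun i _ => ?_
    fun_prop
  constructor
  · rw [tsub_le_iff_right, ← hS]
    refine le_trans (lintegral_mono_ae ?_) le_self_add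
    filter_upwards [hpos] with ω hω
    refine mul_le_of_le_one_right' ?_
    rw [← ENNReal.ofReal_one]
    exact ENNReal.ofReal_le_ofReal
      (survival_le_one h0 hgi (Finset.sum_nonneg fun k _ => (hω k).le))
  · calc ∫⁻ ω, Pr ω ∂P ≤ ∫⁻ ω, (Pr ω * ENNReal.ofReal (survival g (∑ k ∈ Finset.range n, V k ω)) +
          (ENNReal.ofReal e + ENNReal.ofReal (Real.exp Y) *
            ENNReal.ofReal (Real.exp (-∑ k ∈ Finset.range n, V k ω)))) ∂P := by
          refine lintegral_mono_ae ?_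
          filter_upwards [hpos] with ω hω
          calc Pr ω = Pr ω * 1 := (mul_one _).symm
            _ ≤ Pr ω * _ := mul_le_mul_right
              (hbd _ (Finset.sum_nonneg fun k _ => (hω k).le)) _
            _ ≤ _ := by
              rw [mul_add]
              gcongr
              exact mul_le_of_le_one_left' (hle1 n ω)
      _ = ENNReal.ofReal (survival g 0) + (ENNReal.ofReal e +
          ENNReal.ofReal (Real.exp Y) * 2⁻¹ ^ n) := by
          rw [lintegral_add_left (by fun_prop), hS, lintegral_add_left measurable_const,
            lintegral_const, measure_univ, mul_one, lintegral_const_mul _ (by fun_prop),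
            lintegral_exp_neg_arrivals hVm hV hi]
      _ ≤ ENNReal.ofReal (survival g 0) + (ε / 2 + ε / 2) := by gcongr
      _ = _ := by rw [ENNReal.add_halves]

end arrivals

/-! ### Exponents of the finite-dimensional distributions -/

/-- The exponent `∫_0^∞ P(∃ p ∈ J, Z(p.1) > s p.2) ds` of the finite-dimensional distributions of
the max-stable field with spectral field `Z`. -/
noncomputable def exponent {d : ℕ} {Ω : Type*} [MeasurableSpace Ω] (P : Measure Ω)
    (Z : Ω → (Fin d → ℝ) → ℝ) (J : Finset ((Fin d → ℝ) × ℝ)) : ℝ≥0∞ :=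
  ∫⁻ s in Ioi (0 : ℝ), P {ω | ∃ p ∈ J, s * p.2 < Z ω p.1}

section exponent

variable {d : ℕ} {Ω : Type*} [MeasurableSpace Ω] {P : Measure Ω} {Z : Ω → (Fin d → ℝ) → ℝ}
  {J : Finset ((Fin d → ℝ) × ℝ)}

theorem measurableSet_exists_lt (J : Finset ((Fin d → ℝ) × ℝ)) (s : ℝ) :
    MeasurableSet {f : (Fin d → ℝ) → ℝ | ∃ p ∈ J, s * p.2 < f p.1} := by
  have : {f : (Fin d → ℝ) → ℝ | ∃ p ∈ J, s * p.2 < f p.1} =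
      ⋃ p ∈ J, {f : (Fin d → ℝ) → ℝ | s * p.2 < f p.1} := by ext; simp
  rw [this]
  exact J.measurableSet_biUnion fun p _ => measurableSet_lt measurable_const (measurable_pi_apply _)

theorem measurableSet_forall_mem_finset {α β : Type*} [MeasurableSpace α] (J : Finset β)
    {q : β → α → Prop} (h : ∀ p ∈ J, MeasurableSet {x | q p x}) :
    MeasurableSet {x | ∀ p ∈ J, q p x} := by
  have : {x | ∀ p ∈ J, q p x} = ⋂ p ∈ J, {x | q p x} := by ext; simp
  rw [this]
  exact J.measurableSet_biInter h

theorem lintegral_lt_eq (hZm : Measurable Z) {t : Fin d → ℝ} (ht : ∀ᵐ ω ∂P, 0 ≤ Z ω t)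
    {c : ℝ} (hc : 0 < c) :
    ∫⁻ s in Ioi (0 : ℝ), P {ω | s * c < Z ω t} =
      ENNReal.ofReal c⁻¹ * ∫⁻ ω, ENNReal.ofReal (Z ω t) ∂P := by
  have hm : Measurable fun ω => Z ω t := (measurable_pi_apply t).comp hZm
  rw [← lintegral_const_mul _ hm.ennreal_ofReal]
  simp_rw [← ENNReal.ofReal_mul (inv_pos.2 hc).le]
  rw [lintegral_eq_lintegral_meas_lt]
  · refine lintegral_congr fun s => ?_
    congr 1; ext ω
    rw [mem_ofPred, mem_ofPred, inv_mul_eq_div, lt_div_iff₀ hc]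
  · filter_upwards [ht] with ω hω
    have := inv_pos.2 hc
    simp only [Pi.zero_apply]; positivity
  · exact (hm.const_mul _).aemeasurable

theorem exponent_ne_top (hZm : Measurable Z) (hZ0 : ∀ t, ∀ᵐ ω ∂P, 0 ≤ Z ω t)
    (hZ1 : ∀ t, ∫⁻ ω, ENNReal.ofReal (Z ω t) ∂P = 1) (hJ : ∀ p ∈ J, 0 < p.2) :
    exponent P Z J ≠ ∞ := by
  have hle : exponent P Z J ≤ ∑ p ∈ J, ∫⁻ s in Ioi (0 : ℝ), P {ω | s * p.2 < Z ω p.1} := by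
    rw [← lintegral_finsetSum']
    · refine lintegral_mono fun s => ?_
      have : {ω | ∃ p ∈ J, s * p.2 < Z ω p.1} = ⋃ p ∈ J, {ω | s * p.2 < Z ω p.1} := by ext; simp
      simp only [this]
      exact measure_biUnion_finset_le _ _
    · intro p hp
      have : Antitone fun s : ℝ => P {ω | s * p.2 < Z ω p.1} := fun a b hab =>
        measure_mono fun ω (hω : _ < _) =>
          lt_of_le_of_lt (mul_le_mul_of_nonneg_right hab (hJ p hp).le) hω
      exact this.measurable.aemeasurable
  refine ne_top_of_le_ne_top ?_ hle
  refine ENNReal.sum_ne_top.2 fun p hp => ?_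
  rw [lintegral_lt_eq hZm (hZ0 _) (hJ p hp), hZ1]
  simp

end exponent

/-! ### From stationarity of X to shift invariance of the exponents -/

section maxStable

variable {d : ℕ} {Ω Ω' : Type*} [MeasurableSpace Ω] [MeasurableSpace Ω']
  {P : Measure Ω} [IsProbabilityMeasure P] {Z : Ω → (Fin d → ℝ) → ℝ}
  {P' : Measure Ω'} [IsProbabilityMeasure P']
  {V : ℕ → Ω' → ℝ} {W : ℕ → Ω' → (Fin d → ℝ) → ℝ} {J : Finset ((Fin d → ℝ) × ℝ)}

/-- Given the arrival times, the marks are still independent copies of Z, so the conditional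
probability is a product. -/
theorem measure_forall_marks_le (hZm : Measurable Z) (hVm : ∀ k, Measurable (V k))
    (hWm : ∀ k, Measurable (W k)) (hW : ∀ k, IdentDistrib (W k) Z P' P) (hWi : iIndepFun W P')
    (hVW : IndepFun (fun ω k => V k ω) (fun ω k => W k ω) P')
    (J : Finset ((Fin d → ℝ) × ℝ)) (n : ℕ) :
    P' {ω | ∀ i < n, ∀ p ∈ J, W i ω p.1 ≤ (∑ k ∈ Finset.range (i + 1), V k ω) * p.2} =
    ∫⁻ ω, (∏ i ∈ Finset.range n, ENNReal.ofReal
      (1 - P.real {ω' | ∃ p ∈ J, (∑ k ∈ Finset.range (i + 1), V k ω) * p.2 < Z ω' p.1})) ∂P' := by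
  let A : Set ((ℕ → ℝ) × (ℕ → (Fin d → ℝ) → ℝ)) :=
    {q | ∀ i < n, ∀ p ∈ J, q.2 i p.1 ≤ (∑ k ∈ Finset.range (i + 1), q.1 k) * p.2}
  have hA : MeasurableSet A := by
    simp only [A, ← Finset.mem_range (m := _) (n := n)]
    refine measurableSet_forall_mem_finset _ fun i _ =>
      measurableSet_forall_mem_finset J fun p _ => measurableSet_le ?_ ?_
    · exact (measurable_pi_apply p.1).comp ((measurable_pi_apply i).comp measurable_snd)
    · exact (Finset.measurable_sum _ fun k _ =>
        (measurable_pi_apply k).comp measurable_fst).mul_const _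
  have hVs : Measurable fun ω k => V k ω := measurable_pi_lambda _ hVm
  have hWs : Measurable fun ω k => W k ω := measurable_pi_lambda _ hWm
  have key := lintegral_indepFun hVs hWs hVW (F := A.indicator 1) (measurable_one.indicator hA)
  have hL : ∫⁻ ω, A.indicator 1 ((fun k => V k ω), (fun k => W k ω)) ∂P' =
      P' {ω | ∀ i < n, ∀ p ∈ J, W i ω p.1 ≤ (∑ k ∈ Finset.range (i + 1), V k ω) * p.2} := by
    exact lintegral_indicator_one (μ := P') ((hVs.prodMk hWs) hA)
  rw [← hL, key]
  refine lintegral_congr fun ω => ?_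
  have hAω : MeasurableSet (Prod.mk (fun k => V k ω) ⁻¹' A) := measurable_prodMk_left hA
  have : ∀ w : ℕ → (Fin d → ℝ) → ℝ, A.indicator (fun _ => (1 : ℝ≥0∞)) ((fun k => V k ω), w) =
      (Prod.mk (fun k => V k ω) ⁻¹' A).indicator 1 w := fun w => rfl
  refine (lintegral_congr this).trans ?_
  rw [lintegral_indicator_one hAω, Measure.map_apply hWs hAω]
  let B : ℕ → Set ((Fin d → ℝ) → ℝ) := fun i =>
    {f | ∃ p ∈ J, (∑ k ∈ Finset.range (i + 1), V k ω) * p.2 < f p.1}ᶜ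
  have hB : ∀ i, MeasurableSet (B i) := fun i => (measurableSet_exists_lt J _).compl
  have hset : (fun ω k => W k ω) ⁻¹' (Prod.mk (fun k => V k ω) ⁻¹' A) =
      ⋂ i ∈ Finset.range n, W i ⁻¹' B i := by
    ext ω'
    simp [A, B]
  rw [hset, hWi.measure_inter_preimage_eq_mul _ fun i _ => hB i]
  refine Finset.prod_congr rfl fun i _ => ?_
  have hBZ : MeasurableSet {ω' | ∃ p ∈ J, (∑ k ∈ Finset.range (i + 1), V k ω) * p.2 < Z ω' p.1} :=
    hZm (measurableSet_exists_lt J _)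
  rw [(hW i).measure_mem_eq (hB i), ← probReal_compl_eq_one_sub hBZ, ofReal_measureReal]
  rfl

/-- Void probability of a thinned Poisson process: an arrival at y survives the thinning with
probability g(y), and g integrates to the exponent. -/
theorem measure_forall_marks_le_eq_exp (hZm : Measurable Z) (hZ0 : ∀ t, ∀ᵐ ω ∂P, 0 ≤ Z ω t)
    (hZ1 : ∀ t, ∫⁻ ω, ENNReal.ofReal (Z ω t) ∂P = 1) (hJ : ∀ p ∈ J, 0 < p.2)
    (hVm : ∀ k, Measurable (V k)) (hV : ∀ k, P'.map (V k) = expMeasure 1) (hVi : iIndepFun V P')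
    (hWm : ∀ k, Measurable (W k)) (hW : ∀ k, IdentDistrib (W k) Z P' P) (hWi : iIndepFun W P')
    (hVW : IndepFun (fun ω k => V k ω) (fun ω k => W k ω) P') :
    P' {ω | ∀ i, ∀ p ∈ J, W i ω p.1 ≤ (∑ k ∈ Finset.range (i + 1), V k ω) * p.2} =
      ENNReal.ofReal (Real.exp (-(exponent P Z J).toReal)) := by
  set g : ℝ → ℝ := fun y => P.real {ω' | ∃ p ∈ J, y * p.2 < Z ω' p.1} with hg
  have hga : Antitone g := fun a b hab => by
    refine measureReal_mono fun ω' hω => ?_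
    obtain ⟨p, hp, h⟩ := hω
    exact ⟨p, hp, lt_of_le_of_lt (mul_le_mul_of_nonneg_right hab (hJ p hp).le) h⟩
  have h0 : ∀ y, 0 ≤ g y := fun y => measureReal_nonneg
  have h1 : ∀ y, g y ≤ 1 := fun y => measureReal_le_one
  have hlint : ∫⁻ y in Ioi (0 : ℝ), ENNReal.ofReal (g y) = exponent P Z J := by
    refine lintegral_congr fun y => ?_
    rw [hg, ofReal_measureReal]
  have hgi : IntegrableOn g (Ioi 0) := by
    refine ⟨hga.measurable.aestronglyMeasurable, ?_⟩
    rw [hasFiniteIntegral_iff_ofReal (ae_of_all _ h0), hlint]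
    exact (exponent_ne_top hZm hZ0 hZ1 hJ).lt_top
  have hsurv : survival g 0 = Real.exp (-(exponent P Z J).toReal) := by
    rw [survival_zero, ← hlint, integral_eq_lintegral_of_nonneg_ae (ae_of_all _ h0)
      hga.measurable.aestronglyMeasurable]
  rw [← hsurv]
  refine tendsto_nhds_unique ?_ (tendsto_lintegral_arrivals hVm hV hVi hga h0 h1 hgi)
  simp only [hg, ← measure_forall_marks_le hZm hVm hWm hW hWi hVW J]
  have hset : {ω | ∀ i, ∀ p ∈ J, W i ω p.1 ≤ (∑ k ∈ Finset.range (i + 1), V k ω) * p.2} =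
    ⋂ n : ℕ, {ω | ∀ i < n, ∀ p ∈ J, W i ω p.1 ≤ (∑ k ∈ Finset.range (i + 1), V k ω) * p.2} := by
    ext ω
    simp only [mem_ofPred, mem_iInter]
    exact ⟨fun h n i _ => h i, fun h i => h (i + 1) i (Nat.lt_succ_self i)⟩
  rw [hset]
  refine tendsto_measure_iInter_atTop (fun n => ?_) ?_ ⟨0, measure_ne_top _ _⟩
  · simp only [← Finset.mem_range (m := _) (n := n)]
    refine (measurableSet_forall_mem_finset _ fun i _ =>
      measurableSet_forall_mem_finset J fun p _ => measurableSet_le ?_ ?_).nullMeasurableSet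
    · exact (measurable_pi_apply p.1).comp (hWm i)
    · exact (Finset.measurable_sum _ fun k _ => hVm k).mul_const _
  · exact fun a b hab ω h i hi => h i (hi.trans_le hab)

theorem measure_forall_le_eq_exp {X : Ω' → (Fin d → ℝ) → ℝ} (hZm : Measurable Z)
    (hZ0 : ∀ t, ∀ᵐ ω ∂P, 0 ≤ Z ω t)
    (hZ1 : ∀ t, ∫⁻ ω, ENNReal.ofReal (Z ω t) ∂P = 1) (hX : IsSpectralField P Z P' X)
    (hJ : ∀ p ∈ J, 0 < p.2) :
    P' {ω | ∀ p ∈ J, X ω p.1 ≤ p.2} = ENNReal.ofReal (Real.exp (-(exponent P Z J).toReal)) := by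
  obtain ⟨V, W, hVm, hV, hVi, hWm, hW, hWi, hVW, hXe⟩ := hX
  have hpos := ae_pos_of_map_expMeasure hVm hV
  have hΓ : ∀ ω, (∀ k, 0 < V k ω) → ∀ i, 0 < ∑ k ∈ Finset.range (i + 1), V k ω := fun ω h i =>
    Finset.sum_pos (fun k _ => h k) ⟨0, by simp⟩
  -- A real `⨆` over an unbounded family is 0, so almost sure boundedness is needed. The void
  -- probability for the single pair (t, N + 1) is exp(-1/(N + 1)), which tends to 1.
  have hbdd : ∀ t, ∀ᵐ ω ∂P', ∃ N : ℕ, ∀ i,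
      W i ω t ≤ (∑ k ∈ Finset.range (i + 1), V k ω) * (N + 1) := by
    intro t
    have hform : ∀ N : ℕ, P' {ω | ∀ i, W i ω t ≤ (∑ k ∈ Finset.range (i + 1), V k ω) * (N + 1)} =
        ENNReal.ofReal (Real.exp (-((N : ℝ) + 1)⁻¹)) := by
      intro N
      have hN : (0 : ℝ) < N + 1 := by positivity
      have := measure_forall_marks_le_eq_exp (J := {(t, (N : ℝ) + 1)}) hZm hZ0 hZ1
        (by simpa using hN) hVm hV hVi hWm hW hWi hVW
      have he : exponent P Z {(t, (N : ℝ) + 1)} = ENNReal.ofReal ((N : ℝ) + 1)⁻¹ := by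
        have := lintegral_lt_eq (P := P) hZm (hZ0 t) hN
        rw [hZ1, mul_one] at this
        rw [← this, exponent]
        simp
      rw [he, ENNReal.toReal_ofReal (by positivity)] at this
      simpa using this
    have hle : ∀ N : ℕ, ENNReal.ofReal (Real.exp (-((N : ℝ) + 1)⁻¹)) ≤ P' {ω | ∃ N : ℕ, ∀ i,
      W i ω t ≤ (∑ k ∈ Finset.range (i + 1), V k ω) * (N + 1)} := fun N => by
        rw [← hform N]
        exact measure_mono fun ω hω => ⟨N, hω⟩
    have hlim : Tendsto (fun N : ℕ => ENNReal.ofReal (Real.exp (-((N : ℝ) + 1)⁻¹))) atTop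
        (𝓝 (ENNReal.ofReal (Real.exp (-0)))) := by
      refine ENNReal.tendsto_ofReal ((Real.continuous_exp.tendsto _).comp ?_)
      simpa using (tendsto_one_div_add_atTop_nhds_zero_nat (𝕜 := ℝ)).neg
    have h1 := le_of_tendsto' hlim hle
    simp only [neg_zero, Real.exp_zero, ENNReal.ofReal_one] at h1
    have hms : MeasurableSet {ω | ∃ N : ℕ, ∀ i,
        W i ω t ≤ (∑ k ∈ Finset.range (i + 1), V k ω) * (N + 1)} := by
      simp only [ofPred_exists, ofPred_forall]
      refine MeasurableSet.iUnion fun N => MeasurableSet.iInter fun i => measurableSet_le ?_ ?_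
      · exact (measurable_pi_apply t).comp (hWm i)
      · exact (Finset.measurable_sum _ fun k _ => hVm k).mul_const _
    exact (prob_compl_eq_zero_iff hms).2 (le_antisymm prob_le_one h1)
  rw [← measure_forall_marks_le_eq_exp hZm hZ0 hZ1 hJ hVm hV hVi hWm hW hWi hVW]
  refine measure_congr ?_
  have hJe : ∀ᵐ ω ∂P', ∀ p ∈ J, X ω p.1 =
      ⨆ i : ℕ, (∑ k ∈ Finset.range (i + 1), V k ω)⁻¹ * W i ω p.1 :=
    (ae_ball_iff J.countable_toSet).2 fun p _ => hXe p.1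
  have hJb : ∀ᵐ ω ∂P', ∀ p ∈ J, ∃ N : ℕ, ∀ i,
      W i ω p.1 ≤ (∑ k ∈ Finset.range (i + 1), V k ω) * (N + 1) :=
    (ae_ball_iff J.countable_toSet).2 fun p _ => hbdd p.1
  filter_upwards [hpos, hJe, hJb] with ω h1 h2 h3
  have hiff : (∀ p ∈ J, X ω p.1 ≤ p.2) ↔
      ∀ i, ∀ p ∈ J, W i ω p.1 ≤ (∑ k ∈ Finset.range (i + 1), V k ω) * p.2 := by
    rw [forall_comm]
    refine forall_congr' fun p => ?_
    rw [forall_comm]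
    refine forall_congr' fun hp => ?_
    rw [h2 p hp, ciSup_le_iff]
    · exact forall_congr' fun i => inv_mul_le_iff₀ (hΓ ω h1 i)
    · obtain ⟨N, hN⟩ := h3 p hp
      exact ⟨N + 1, by rintro _ ⟨i, rfl⟩; exact (inv_mul_le_iff₀ (hΓ ω h1 i)).2 (hN i)⟩
  exact propext hiff

/-- Exponents are finite, so they can be recovered from the distribution of X by taking logarithms.
-/
theorem exponent_shift {X : Ω' → (Fin d → ℝ) → ℝ} (hZm : Measurable Z)
    (hZ0 : ∀ t, ∀ᵐ ω ∂P, 0 ≤ Z ω t)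
    (hZ1 : ∀ t, ∫⁻ ω, ENNReal.ofReal (Z ω t) ∂P = 1) (hX : IsSpectralField P Z P' X)
    (hXs : IsStationaryField P' X) (hJ : ∀ p ∈ J, 0 < p.2) (h : Fin d → ℝ) :
    exponent P (fun ω t => Z ω (t + h)) J = exponent P Z J := by
  classical
  let J' : Finset ((Fin d → ℝ) × ℝ) := J.image fun p => (p.1 + h, p.2)
  have hJ' : ∀ p ∈ J', 0 < p.2 := by
    simp only [J', Finset.mem_image]
    rintro _ ⟨p, hp, rfl⟩
    exact hJ p hp
  have he : exponent P (fun ω t => Z ω (t + h)) J = exponent P Z J' := by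
    refine lintegral_congr fun s => ?_
    congr 1; ext ω
    simp only [mem_ofPred, J', Finset.exists_mem_image]
  rw [he]
  have h1 := measure_forall_le_eq_exp hZm hZ0 hZ1 hX hJ
  have h2 := measure_forall_le_eq_exp hZm hZ0 hZ1 hX hJ'
  have hms : MeasurableSet {f : (Fin d → ℝ) → ℝ | ∀ p ∈ J, f p.1 ≤ p.2} := by
    exact measurableSet_forall_mem_finset J fun p _ =>
      measurableSet_le (measurable_pi_apply _) measurable_const
  have h3 : P' {ω | ∀ p ∈ J', X ω p.1 ≤ p.2} = P' {ω | ∀ p ∈ J, X ω p.1 ≤ p.2} := by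
    have := (hXs h).measure_mem_eq hms
    simp only [preimage_ofPred_eq] at this
    rw [← this]
    congr 1; ext ω
    simp only [mem_ofPred, J', Finset.forall_mem_image]
  rw [h1, h2, ENNReal.ofReal_eq_ofReal_iff (Real.exp_pos _).le (Real.exp_pos _).le,
    Real.exp_eq_exp, neg_inj, ENNReal.toReal_eq_toReal_iff'
    (exponent_ne_top hZm hZ0 hZ1 hJ') (exponent_ne_top hZm hZ0 hZ1 hJ)] at h3
  exact h3

end maxStable

/-! ### The exponent measure, its invariance, and the law of RΘ -/

/-- The image of `P ⊗ ds` under `(ω, s) ↦ Z(ω) / s`, i.e. the exponent measure of the max-stable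
field with spectral field `Z`. -/
noncomputable def exponentMeasure {d : ℕ} {Ω : Type*} [MeasurableSpace Ω] (P : Measure Ω)
    (Z : Ω → (Fin d → ℝ) → ℝ) : Measure ((Fin d → ℝ) → ℝ) :=
  (P.prod (volume.restrict (Ioi (0 : ℝ)))).map (fun q t => Z q.1 t / q.2)

section exponentMeasure

variable {d : ℕ} {Ω : Type*} [MeasurableSpace Ω] {P : Measure Ω} [IsProbabilityMeasure P]
  {Z : Ω → (Fin d → ℝ) → ℝ}

theorem measurable_div_field (hZm : Measurable Z) :
    Measurable fun (q : Ω × ℝ) (t : Fin d → ℝ) => Z q.1 t / q.2 :=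
  measurable_pi_lambda _ fun t =>
    ((measurable_pi_apply t).comp (hZm.comp measurable_fst)).div measurable_snd

instance : SFinite (exponentMeasure P Z) := by unfold exponentMeasure; infer_instance

theorem lintegral_exponentMeasure (hZm : Measurable Z) {F : ((Fin d → ℝ) → ℝ) → ℝ≥0∞}
    (hF : Measurable F) :
    ∫⁻ f, F f ∂(exponentMeasure P Z) =
      ∫⁻ s in Ioi (0 : ℝ), ∫⁻ ω, F (fun t => Z ω t / s) ∂P := by
  rw [exponentMeasure, lintegral_map hF (measurable_div_field hZm)]
  exact lintegral_prod_symm' _ (hF.comp (measurable_div_field hZm))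

theorem exponentMeasure_apply (hZm : Measurable Z) {S : Set ((Fin d → ℝ) → ℝ)}
    (hS : MeasurableSet S) :
    exponentMeasure P Z S = ∫⁻ s in Ioi (0 : ℝ), P {ω | (fun t => Z ω t / s) ∈ S} := by
  rw [exponentMeasure, Measure.map_apply (measurable_div_field hZm) hS,
    Measure.prod_apply_symm (measurable_div_field hZm hS)]
  rfl

theorem measurableSet_exists_mem_lt (J : Finset ((Fin d → ℝ) × ℝ)) :
    MeasurableSet {f : (Fin d → ℝ) → ℝ | ∃ p ∈ J, p.2 < f p.1} := by
  simpa using measurableSet_exists_lt J 1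

theorem exponentMeasure_exists_lt (hZm : Measurable Z) (J : Finset ((Fin d → ℝ) × ℝ)) :
    exponentMeasure P Z {f | ∃ p ∈ J, p.2 < f p.1} = exponent P Z J := by
  rw [exponentMeasure_apply hZm (measurableSet_exists_mem_lt J)]
  refine setLIntegral_congr_fun measurableSet_Ioi fun s hs => ?_
  have hs : (0 : ℝ) < s := hs
  congr 1; ext ω
  simp only [mem_ofPred, lt_div_iff₀ hs, mul_comm]

theorem exponentMeasure_neg (hZm : Measurable Z) {t : Fin d → ℝ} (ht : ∀ᵐ ω ∂P, 0 ≤ Z ω t) :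
    exponentMeasure P Z {f | f t < 0} = 0 := by
  rw [exponentMeasure_apply hZm (measurableSet_lt (measurable_pi_apply t) measurable_const),
    setLIntegral_congr_fun measurableSet_Ioi (g := fun _ => 0)]
  · simp
  · intro s hs
    have hs : (0 : ℝ) < s := hs
    refine measure_mono_null (fun ω hω => ?_) (ae_iff.1 ht)
    simp only [mem_ofPred, div_neg_iff, not_le] at hω ⊢
    rcases hω with h | h
    · linarith [h.2]
    · exact h.1

theorem measurableSet_one_lt_zero :
    MeasurableSet {f : (Fin d → ℝ) → ℝ | 1 < f 0} :=
  measurableSet_lt measurable_const (measurable_pi_apply _)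

/-- The set in question is the difference of two exceedance sets of finite mass, so its mass is a
function of exponents. -/
theorem restrict_exponentMeasure_forall_le (hZm : Measurable Z) (hZ0 : ∀ t, ∀ᵐ ω ∂P, 0 ≤ Z ω t)
    (hZ1 : ∀ t, ∫⁻ ω, ENNReal.ofReal (Z ω t) ∂P = 1) {J : Finset ((Fin d → ℝ) × ℝ)}
    (hJ : ∀ p ∈ J, 0 < p.2) :
    (exponentMeasure P Z).restrict {f | 1 < f 0} {f | ∀ p ∈ J, f p.1 ≤ p.2} =
      exponent P Z (J ∪ {(0, 1)}) - exponent P Z J := by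
  rw [Measure.restrict_apply' measurableSet_one_lt_zero, ← exponentMeasure_exists_lt hZm,
    ← exponentMeasure_exists_lt hZm, ← measure_sdiff _
      (measurableSet_exists_mem_lt J).nullMeasurableSet]
  · congr 1; ext f
    simp only [mem_inter_iff, Set.mem_sdiff, mem_ofPred, Finset.mem_union, Finset.mem_singleton]
    constructor
    · rintro ⟨h1, h2⟩
      exact ⟨⟨_, Or.inr rfl, h2⟩, by push Not; exact h1⟩
    · rintro ⟨⟨p, h1, h2⟩, h3⟩
      push Not at h3
      refine ⟨h3, ?_⟩
      rcases h1 with h1 | rfl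
      · exact absurd h2 (not_lt.2 (h3 p h1))
      · exact h2
  · rw [exponentMeasure_exists_lt hZm]; exact exponent_ne_top hZm hZ0 hZ1 hJ
  · rintro f ⟨p, h1, h2⟩
    exact ⟨p, Finset.mem_union_left _ h1, h2⟩

theorem pi_eq_generateFrom_forall_le {α : Type*} :
    (MeasurableSpace.pi : MeasurableSpace (α → ℝ)) = MeasurableSpace.generateFrom
      {S | ∃ J : Finset (α × ℝ), S = {f | ∀ p ∈ J, f p.1 ≤ p.2}} := by
  apply le_antisymm
  · refine iSup_le fun t => ?_
    rw [BorelSpace.measurable_eq (α := ℝ), borel_eq_generateFrom_Iic ℝ,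
      MeasurableSpace.comap_generateFrom]
    refine MeasurableSpace.generateFrom_mono ?_
    rintro _ ⟨_, ⟨x, rfl⟩, rfl⟩
    refine ⟨{(t, x)}, ?_⟩
    ext f; simp
  · refine MeasurableSpace.generateFrom_le ?_
    rintro _ ⟨J, rfl⟩
    exact measurableSet_forall_mem_finset J fun p _ =>
      measurableSet_le (measurable_pi_apply _) measurable_const

/-- The sets of paths below finitely many levels form a generating π-system. Exponents settle
positive levels; levels that may be 0 are decreasing limits of positive ones; a negative level gives
a null set because the fields are non-negative. -/
theorem restrict_exponentMeasure_congr {Z' : Ω → (Fin d → ℝ) → ℝ}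
    (hZm : Measurable Z) (hZ0 : ∀ t, ∀ᵐ ω ∂P, 0 ≤ Z ω t)
    (hZ1 : ∀ t, ∫⁻ ω, ENNReal.ofReal (Z ω t) ∂P = 1)
    (hZm' : Measurable Z') (hZ0' : ∀ t, ∀ᵐ ω ∂P, 0 ≤ Z' ω t)
    (hZ1' : ∀ t, ∫⁻ ω, ENNReal.ofReal (Z' ω t) ∂P = 1)
    (h : ∀ J : Finset ((Fin d → ℝ) × ℝ), (∀ p ∈ J, 0 < p.2) → exponent P Z' J = exponent P Z J) :
    (exponentMeasure P Z').restrict {f | 1 < f 0} =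
      (exponentMeasure P Z).restrict {f | 1 < f 0} := by
  classical
  have hfin : ∀ {Z : Ω → (Fin d → ℝ) → ℝ}, Measurable Z → (∀ t, ∀ᵐ ω ∂P, 0 ≤ Z ω t) →
      (∀ t, ∫⁻ ω, ENNReal.ofReal (Z ω t) ∂P = 1) →
      IsFiniteMeasure ((exponentMeasure P Z).restrict {f : (Fin d → ℝ) → ℝ | 1 < f 0}) := by
    intro Z a b c
    refine isFiniteMeasure_restrict.2 ?_
    have := exponentMeasure_exists_lt (P := P) a {((0 : Fin d → ℝ), (1 : ℝ))}
    simp only [Finset.mem_singleton, exists_eq_left] at this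
    rw [this]
    exact exponent_ne_top a b c (by simp)
  have hf1 := hfin hZm hZ0 hZ1
  have hf2 := hfin hZm' hZ0' hZ1'
  have hposJ : ∀ J : Finset ((Fin d → ℝ) × ℝ), (∀ p ∈ J, 0 < p.2) →
      (exponentMeasure P Z').restrict {f | 1 < f 0} {f | ∀ p ∈ J, f p.1 ≤ p.2} =
      (exponentMeasure P Z).restrict {f | 1 < f 0} {f | ∀ p ∈ J, f p.1 ≤ p.2} := by
    intro J hJ
    rw [restrict_exponentMeasure_forall_le hZm hZ0 hZ1 hJ,
      restrict_exponentMeasure_forall_le hZm' hZ0' hZ1' hJ, h J hJ, h]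
    intro p hp
    rcases Finset.mem_union.1 hp with hp | hp
    · exact hJ p hp
    · rw [Finset.mem_singleton.1 hp]; exact one_pos
  refine ext_of_generate_finite _ pi_eq_generateFrom_forall_le ?_ ?_ ?_
  · rintro _ ⟨J, rfl⟩ _ ⟨J', rfl⟩ -
    refine ⟨J ∪ J', ?_⟩
    ext f
    simp only [mem_inter_iff, mem_ofPred, Finset.mem_union]
    exact ⟨fun h p hp => hp.elim (h.1 p) (h.2 p), fun h => ⟨fun p hp => h p (Or.inl hp),
      fun p hp => h p (Or.inr hp)⟩⟩
  · rintro _ ⟨J, rfl⟩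
    by_cases hJ : ∃ p ∈ J, p.2 < 0
    · obtain ⟨p, hp, hp0⟩ := hJ
      have hz : ∀ {Z : Ω → (Fin d → ℝ) → ℝ}, Measurable Z → (∀ t, ∀ᵐ ω ∂P, 0 ≤ Z ω t) →
          (exponentMeasure P Z).restrict {f | 1 < f 0} {f | ∀ p ∈ J, f p.1 ≤ p.2} = 0 := by
        intro Z a b
        refine le_antisymm ((Measure.restrict_apply_le _ _).trans ?_) zero_le
        rw [← exponentMeasure_neg a (b p.1)]
        exact measure_mono fun f hf => (hf p hp).trans_lt hp0
      rw [hz hZm hZ0, hz hZm' hZ0']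
    · push Not at hJ
      let K : ℕ → Finset ((Fin d → ℝ) × ℝ) := fun n => J.image fun p => (p.1, p.2 + 1 / ((n : ℝ) + 1))
      have hK : ∀ n, ∀ p ∈ K n, 0 < p.2 := by
        intro n
        simp only [K, Finset.forall_mem_image]
        intro p hp
        have := hJ p hp
        positivity
      have hset : {f : (Fin d → ℝ) → ℝ | ∀ p ∈ J, f p.1 ≤ p.2} =
          ⋂ n, {f | ∀ p ∈ K n, f p.1 ≤ p.2} := by
        ext f
        simp only [mem_ofPred, mem_iInter, K, Finset.forall_mem_image]
        constructor
        · intro h n p hp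
          have := h p hp
          have : (0 : ℝ) < 1 / ((n : ℝ) + 1) := by positivity
          linarith
        · intro h p hp
          have hl : Tendsto (fun n : ℕ => p.2 + 1 / ((n : ℝ) + 1)) atTop (𝓝 (p.2 + 0)) :=
            tendsto_const_nhds.add tendsto_one_div_add_atTop_nhds_zero_nat
          rw [add_zero] at hl
          exact ge_of_tendsto' hl fun n => h n hp
      have hlim : ∀ μ : Measure ((Fin d → ℝ) → ℝ), IsFiniteMeasure μ →
          Tendsto (fun n => μ {f | ∀ p ∈ K n, f p.1 ≤ p.2}) atTop
            (𝓝 (μ {f | ∀ p ∈ J, f p.1 ≤ p.2})) := by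
        intro μ _
        rw [hset]
        refine tendsto_measure_iInter_atTop (fun n => ?_) ?_ ⟨0, measure_ne_top _ _⟩
        · exact (measurableSet_forall_mem_finset _ fun p _ =>
            measurableSet_le (measurable_pi_apply _) measurable_const).nullMeasurableSet
        · intro a b hab f hf
          simp only [mem_ofPred, K, Finset.forall_mem_image] at hf ⊢
          exact fun p hp => (hf hp).trans (by
            have := one_div_le_one_div_of_le (by positivity : (0 : ℝ) < (a : ℝ) + 1)
              (show (a : ℝ) + 1 ≤ (b : ℝ) + 1 by gcongr)
            linarith)
      have h1 := hlim _ hf1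
      have h2 := hlim _ hf2
      simp only [hposJ _ (hK _)] at h2
      exact tendsto_nhds_unique h2 h1
  · have := hposJ ∅ (by simp)
    simpa using this

/-- Substitution r = z/s: the Jacobian z/s² cancels the Pareto density s²/z² times the weight z. -/
theorem lintegral_pareto_rescale {z : ℝ} (hz : 0 < z) (φ : ℝ → ℝ≥0∞) :
    ∫⁻ r in Ioi (1 : ℝ), ENNReal.ofReal (r ^ (-2 : ℝ)) * (ENNReal.ofReal z * φ (r / z)) =
      ∫⁻ s in Ioo (0 : ℝ) z, φ s⁻¹ := by
  have himg : (fun s => z / s) '' Ioo (0 : ℝ) z = Ioi 1 := by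
    ext r
    simp only [mem_image, mem_Ioo, mem_Ioi]
    constructor
    · rintro ⟨s, ⟨h1, h2⟩, rfl⟩
      exact (one_lt_div h1).2 h2
    · intro hr
      have hr0 : 0 < r := one_pos.trans hr
      exact ⟨z / r, ⟨by positivity, div_lt_self hz hr⟩, by field_simp⟩
  rw [← himg, lintegral_image_eq_lintegral_abs_deriv_mul (f' := fun s => -z / s ^ 2)
    measurableSet_Ioo]
  · refine setLIntegral_congr_fun measurableSet_Ioo fun s hs => ?_
    have hs0 : 0 < s := hs.1
    rw [← mul_assoc, ← mul_assoc, ← ENNReal.ofReal_mul (abs_nonneg _),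
      ← ENNReal.ofReal_mul (by positivity)]
    have e1 : z / s / z = s⁻¹ := by field_simp
    have e2 : |-z / s ^ 2| * (z / s) ^ (-2 : ℝ) * z = 1 := by
      rw [abs_div, abs_neg, abs_of_pos hz, abs_of_pos (by positivity : 0 < s ^ 2),
        show (-2 : ℝ) = ((-2 : ℤ) : ℝ) by norm_num, Real.rpow_intCast]
      simp only [zpow_neg, zpow_ofNat]
      field_simp
    rw [e1, e2, ENNReal.ofReal_one, one_mul]
  · intro s hs
    have := ((hasDerivAt_const s z).div (hasDerivAt_id s) hs.1.ne').hasDerivWithinAt (s := Ioo 0 z)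
    refine this.congr_deriv ?_
    simp
  · intro a ha b hb hab
    have ha0 := ha.1
    have hb0 := hb.1
    simp only at hab
    field_simp at hab
    exact hab.symm

theorem lintegral_paretoMeasure_one (f : ℝ → ℝ≥0∞) (hf : Measurable f) :
    ∫⁻ r, f r ∂(paretoMeasure 1 1) =
      ∫⁻ r in Ioi (1 : ℝ), ENNReal.ofReal (r ^ (-2 : ℝ)) * f r := by
  have hm : Measurable (paretoPDF 1 1) := (measurable_paretoPDFReal 1 1).ennreal_ofReal
  rw [paretoMeasure, lintegral_withDensity_eq_lintegral_mul _ hm hf,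
    ← setLIntegral_congr (Ioi_ae_eq_Ici (a := (1 : ℝ))).symm, ← lintegral_indicator measurableSet_Ici]
  refine lintegral_congr fun v => ?_
  rw [Pi.mul_apply, paretoPDF, paretoPDFReal]
  by_cases h : 1 ≤ v
  · rw [indicator_of_mem (show v ∈ Ici (1 : ℝ) from h), if_pos h]
    norm_num
  · rw [indicator_of_notMem (show v ∉ Ici (1 : ℝ) from h), if_neg h]
    simp

/-- For a fixed path with Z(0) > 0, the substitution r = Z(0)/s turns the Pareto law weighted by
Z(0) into ds on (0, Z(0)), which is exactly the range where Z(0)/s > 1. Paths with Z(0) = 0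
contribute nothing to either side. -/
theorem map_pareto_mul_tilted {Ω'' : Type*} [MeasurableSpace Ω''] (hZm : Measurable Z)
    (hZ0 : ∀ t, ∀ᵐ ω ∂P, 0 ≤ Z ω t)
    (Q : Measure Ω'') [IsProbabilityMeasure Q] {Θ : Ω'' → (Fin d → ℝ) → ℝ} (hΘm : Measurable Θ)
    (hΘ : Q.map Θ = tiltedLaw P Z) {R : Ω'' → ℝ} (hRm : Measurable R)
    (hR : Q.map R = paretoMeasure 1 1) (hRΘ : IndepFun R Θ Q) :
    Q.map (fun ω t => R ω * Θ ω t) = (exponentMeasure P Z).restrict {f | 1 < f 0} := by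
  have hYm : Measurable fun ω t => R ω * Θ ω t :=
    measurable_pi_lambda _ fun t => hRm.mul ((measurable_pi_apply t).comp hΘm)
  have hZ0m : Measurable fun ω => Z ω 0 := (measurable_pi_apply 0).comp hZm
  refine Measure.ext fun S hS => ?_
  have hmulm : Measurable fun (q : ℝ × ((Fin d → ℝ) → ℝ)) (t : Fin d → ℝ) => q.1 * q.2 t :=
    measurable_pi_lambda _ fun t =>
      measurable_fst.mul ((measurable_pi_apply t).comp measurable_snd)
  let F : ℝ × ((Fin d → ℝ) → ℝ) → ℝ≥0∞ := fun q => S.indicator 1 (fun t => q.1 * q.2 t)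
  have hF : Measurable F := (measurable_one.indicator hS).comp hmulm
  have hdivm : Measurable fun ω t => Z ω t / Z ω 0 :=
    measurable_pi_lambda _ fun t => ((measurable_pi_apply t).comp hZm).div hZ0m
  have h1 : Q.map (fun ω t => R ω * Θ ω t) S =
      ∫⁻ r in Ioi (1 : ℝ), ENNReal.ofReal (r ^ (-2 : ℝ)) *
        ∫⁻ ω, ENNReal.ofReal (Z ω 0) * F (r, fun t => Z ω t / Z ω 0) ∂P := by
    rw [← lintegral_indicator_one hS, lintegral_map (measurable_one.indicator hS) hYm]
    have := lintegral_indepFun hRm hΘm hRΘ hF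
    refine this.trans ?_
    rw [hΘ, ← lintegral_map (f := fun r => ∫⁻ y, F (r, y) ∂(tiltedLaw P Z)) (g := R)
      (by
        have : SFinite (tiltedLaw P Z) := by rw [← hΘ]; infer_instance
        exact hF.lintegral_prod_right') hRm, hR, lintegral_paretoMeasure_one]
    · refine lintegral_congr fun r => ?_
      congr 1
      have hFr : Measurable fun y => F (r, y) := hF.comp measurable_prodMk_left
      rw [tiltedLaw, lintegral_map hFr hdivm]
      exact lintegral_withDensity_eq_lintegral_mul _ hZ0m.ennreal_ofReal (hFr.comp hdivm)
    · have : SFinite (tiltedLaw P Z) := by rw [← hΘ]; infer_instance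
      exact hF.lintegral_prod_right'
  have hT : MeasurableSet (S ∩ {f : (Fin d → ℝ) → ℝ | 1 < f 0}) := hS.inter measurableSet_one_lt_zero
  have h2 : (exponentMeasure P Z).restrict {f | 1 < f 0} S =
      ∫⁻ ω, (∫⁻ s in Ioi (0 : ℝ), (S ∩ {f | 1 < f 0}).indicator 1 (fun t => Z ω t / s)) ∂P := by
    rw [Measure.restrict_apply' measurableSet_one_lt_zero, ← lintegral_indicator_one hT,
      exponentMeasure, lintegral_map (measurable_one.indicator hT) (measurable_div_field hZm)]
    exact lintegral_prod _
      ((measurable_one.indicator hT).comp (measurable_div_field hZm)).aemeasurable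
  rw [h1, h2]
  have hGm : Measurable fun q : ℝ × Ω =>
      ENNReal.ofReal (Z q.2 0) * F (q.1, fun t => Z q.2 t / Z q.2 0) :=
    (hZ0m.comp measurable_snd).ennreal_ofReal.mul
      (hF.comp (measurable_fst.prodMk (hdivm.comp measurable_snd)))
  have hpm : Measurable fun r : ℝ => ENNReal.ofReal (r ^ (-2 : ℝ)) := by fun_prop
  have e0 : ∀ r : ℝ, ENNReal.ofReal (r ^ (-2 : ℝ)) *
      ∫⁻ ω, ENNReal.ofReal (Z ω 0) * F (r, fun t => Z ω t / Z ω 0) ∂P =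
      ∫⁻ ω, ENNReal.ofReal (r ^ (-2 : ℝ)) *
        (ENNReal.ofReal (Z ω 0) * F (r, fun t => Z ω t / Z ω 0)) ∂P := fun r =>
    (lintegral_const_mul _ (hGm.comp measurable_prodMk_left)).symm
  rw [lintegral_congr e0, lintegral_lintegral_swap ((hpm.comp measurable_fst).mul hGm).aemeasurable]
  refine lintegral_congr_ae ?_
  filter_upwards [hZ0 0] with ω hω
  rcases hω.eq_or_lt with h | h
  · rw [← h]
    simp only [ENNReal.ofReal_zero, zero_mul, mul_zero, lintegral_zero]
    rw [eq_comm, setLIntegral_congr_fun measurableSet_Ioi (g := fun _ => 0), lintegral_zero]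
    intro s hs
    refine indicator_of_notMem ?_ _
    rintro ⟨-, h3⟩
    have h3 : 1 < Z ω 0 / s := h3
    rw [← h, zero_div] at h3
    exact absurd h3 (by norm_num)
  · have := lintegral_pareto_rescale h fun c => F (c, Z ω)
    have e : ∀ r, F (r, fun t => Z ω t / Z ω 0) = F (r / Z ω 0, Z ω) := fun r => by
      simp only [F]; congr 1; ext t; ring
    simp only [e]
    rw [this, ← lintegral_indicator measurableSet_Ioo, ← lintegral_indicator measurableSet_Ioi]
    refine lintegral_congr fun s => ?_
    by_cases hs : 0 < s
    · rw [indicator_of_mem (show s ∈ Ioi (0 : ℝ) from hs)]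
      have e2 : (fun t => s⁻¹ * Z ω t) = fun t => Z ω t / s := by ext t; ring
      by_cases hs2 : s < Z ω 0
      · rw [indicator_of_mem (show s ∈ Ioo (0 : ℝ) (Z ω 0) from ⟨hs, hs2⟩)]
        simp only [F, e2]
        by_cases h3 : (fun t => Z ω t / s) ∈ S
        · rw [indicator_of_mem h3, indicator_of_mem (show _ ∈ S ∩ {f : (Fin d → ℝ) → ℝ | 1 < f 0} from
            ⟨h3, (one_lt_div hs).2 hs2⟩)]
        · rw [indicator_of_notMem h3, indicator_of_notMem fun h4 => h3 h4.1]
      · rw [indicator_of_notMem fun h4 => hs2 h4.2, indicator_of_notMem fun h4 =>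
          hs2 ((one_lt_div hs).1 h4.2)]
    · rw [indicator_of_notMem fun h4 => hs h4.1, indicator_of_notMem (show s ∉ Ioi (0 : ℝ) from hs)]

end exponentMeasure

/-! ### Measurable version of the sojourn -/

section excursion

variable {d : ℕ}

/-- Continuity from the upper orthant at every point. -/
def UpperContinuous (f : (Fin d → ℝ) → ℝ) : Prop :=
  ∀ t, ContinuousWithinAt f (Ici t) t

theorem UpperContinuous.comp_add {f : (Fin d → ℝ) → ℝ} (hf : UpperContinuous f) (h : Fin d → ℝ) :
    UpperContinuous fun t => f (t + h) := fun t =>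
  ContinuousWithinAt.comp (t := Ici (t + h)) (hf (t + h))
    (continuous_add_const h).continuousWithinAt
    fun _ hs => add_le_add_left (mem_Ici.1 hs) h

theorem UpperContinuous.div_const {f : (Fin d → ℝ) → ℝ} (hf : UpperContinuous f) (c : ℝ) :
    UpperContinuous fun t => f t / c := fun t => (hf t).div_const c

theorem UpperContinuous.const_mul {f : (Fin d → ℝ) → ℝ} (hf : UpperContinuous f) (c : ℝ) :
    UpperContinuous fun t => c * f t := fun t => (hf t).const_mul c

theorem UpperContinuous.of_mem_cadlagSpace {f : (Fin d → ℝ) → ℝ} (hf : f ∈ cadlagSpace d) :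
    UpperContinuous f := fun t => (hf.2 t).1

/-- The smallest point of the grid `(n + 1)⁻¹ ℤ^d` that is strictly above `t`. -/
noncomputable def gridAbove (n : ℕ) (t : Fin d → ℝ) : Fin d → ℝ :=
  fun i => ((⌊((n : ℝ) + 1) * t i⌋ : ℝ) + 1) / ((n : ℝ) + 1)

theorem le_gridAbove (n : ℕ) (t : Fin d → ℝ) : t ≤ gridAbove n t := fun i => by
  have hn : (0 : ℝ) < (n : ℝ) + 1 := by positivity
  rw [gridAbove, le_div_iff₀ hn, mul_comm]
  exact (Int.lt_floor_add_one _).le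

theorem tendsto_gridAbove (t : Fin d → ℝ) :
    Tendsto (fun n => gridAbove n t) atTop (𝓝[Ici t] t) := by
  refine tendsto_nhdsWithin_iff.2 ⟨?_, Eventually.of_forall fun n => le_gridAbove n t⟩
  refine tendsto_pi_nhds.2 fun i => ?_
  have hu : Tendsto (fun n : ℕ => t i + 1 / ((n : ℝ) + 1)) atTop (𝓝 (t i + 0)) :=
    tendsto_const_nhds.add tendsto_one_div_add_atTop_nhds_zero_nat
  rw [add_zero] at hu
  refine tendsto_of_tendsto_of_tendsto_of_le_of_le tendsto_const_nhds hu
    (fun n => le_gridAbove n t i) fun n => ?_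
  have hn : (0 : ℝ) < (n : ℝ) + 1 := by positivity
  have e : (t i + 1 / ((n : ℝ) + 1)) * ((n : ℝ) + 1) = ((n : ℝ) + 1) * t i + 1 := by field_simp
  rw [gridAbove, div_le_iff₀ hn, e]
  gcongr
  exact Int.floor_le _

/-- A jointly measurable function of `(f, t)` that equals `f t` if `f` is non-negative and
continuous from the upper orthant. -/
noncomputable def upperLimit (f : (Fin d → ℝ) → ℝ) (t : Fin d → ℝ) : ℝ≥0∞ :=
  limsup (fun n => ENNReal.ofReal (f (gridAbove n t))) atTop

/-- For each n the evaluation point depends on t only through an integer vector. Countably many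
values make evaluation jointly measurable, which it is not for the product σ-field in general. -/
theorem measurable_upperLimit :
    Measurable fun q : ((Fin d → ℝ) → ℝ) × (Fin d → ℝ) => upperLimit q.1 q.2 := by
  refine Measurable.limsup fun n => Measurable.ennreal_ofReal ?_
  have h1 : Measurable fun q : ((Fin d → ℝ) → ℝ) × (Fin d → ℤ) =>
      q.1 (fun i => ((q.2 i : ℝ) + 1) / ((n : ℝ) + 1)) :=
    measurable_from_prod_countable_left fun k =>
      measurable_pi_apply fun i => ((k i : ℝ) + 1) / ((n : ℝ) + 1)
  have h2 : Measurable fun q : ((Fin d → ℝ) → ℝ) × (Fin d → ℝ) =>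
      (q.1, fun i => ⌊((n : ℝ) + 1) * q.2 i⌋) :=
    measurable_fst.prodMk (measurable_pi_lambda _ fun i => Int.measurable_floor.comp
      (((measurable_pi_apply i).comp measurable_snd).const_mul _))
  exact h1.comp h2

theorem UpperContinuous.upperLimit_eq {f : (Fin d → ℝ) → ℝ} (hf : UpperContinuous f)
    (t : Fin d → ℝ) : upperLimit f t = ENNReal.ofReal (f t) :=
  (ENNReal.tendsto_ofReal ((hf t).tendsto.comp (tendsto_gridAbove t))).limsup_eq

/-- A measurable version of the sojourn `f ↦ μ {t ∈ A | 1 < f t}`. -/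
noncomputable def excursion (μ : Measure (Fin d → ℝ)) (A : Set (Fin d → ℝ))
    (f : (Fin d → ℝ) → ℝ) : ℝ≥0∞ :=
  μ {t | t ∈ A ∧ 1 < upperLimit f t}

variable {μ : Measure (Fin d → ℝ)} {A : Set (Fin d → ℝ)}

theorem measurableSet_one_lt_upperLimit :
    MeasurableSet {q : ((Fin d → ℝ) → ℝ) × (Fin d → ℝ) | 1 < upperLimit q.1 q.2} :=
  measurableSet_lt measurable_const measurable_upperLimit

theorem measurableSet_excursion (hA : MeasurableSet A) (f : (Fin d → ℝ) → ℝ) :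
    MeasurableSet {t | t ∈ A ∧ 1 < upperLimit f t} :=
  hA.inter (measurable_prodMk_left measurableSet_one_lt_upperLimit)

theorem measurable_excursion [SFinite μ] (hA : MeasurableSet A) :
    Measurable (excursion μ A) :=
  measurable_measure_prodMk_left ((measurable_snd hA).inter measurableSet_one_lt_upperLimit)

theorem excursion_mono {B : Set (Fin d → ℝ)} (h : A ⊆ B) (f : (Fin d → ℝ) → ℝ) :
    excursion μ A f ≤ excursion μ B f :=
  measure_mono fun _ ht => ⟨h ht.1, ht.2⟩

theorem excursion_le (f : (Fin d → ℝ) → ℝ) : excursion μ A f ≤ μ A :=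
  measure_mono fun _ ht => ht.1

theorem UpperContinuous.excursion_eq {f : (Fin d → ℝ) → ℝ} (hf : UpperContinuous f) :
    excursion μ A f = μ {t | t ∈ A ∧ 1 < f t} := by
  simp only [excursion, hf.upperLimit_eq, ENNReal.one_lt_ofReal]

theorem UpperContinuous.excursion_comp_add {f : (Fin d → ℝ) → ℝ} (hf : UpperContinuous f)
    (hA : MeasurableSet A) {h : Fin d → ℝ} (hμ : μ.map (· + h) = μ) :
    excursion μ ((· + h) ⁻¹' A) (fun t => f (t + h)) = excursion μ A f := by
  have hms := measurableSet_excursion hA f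
  conv_rhs => rw [excursion, ← hμ, Measure.map_apply (measurable_add_const h) hms]
  rw [(hf.comp_add h).excursion_eq]
  simp only [hf.upperLimit_eq, ENNReal.one_lt_ofReal]
  rfl

end excursion

/-! ### Mass transport identity -/

section massTransport

variable {d : ℕ} {Ω : Type*} [MeasurableSpace Ω] {P : Measure Ω} [IsProbabilityMeasure P]
  {Z : Ω → (Fin d → ℝ) → ℝ} {μ : Measure (Fin d → ℝ)} [SFinite μ] {A : Set (Fin d → ℝ)}

/-- Expand the second factor as an integral over t ∈ A, exchange, and recentre at t: the event f(t)
> 1 becomes f(0) > 1 and A becomes A - t. Invariance of μ is only asked for almost every t, since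
λ_δ is invariant only under lattice shifts. -/
theorem lintegral_excursion_mul (hZm : Measurable Z) (hZc : ∀ᵐ ω ∂P, UpperContinuous (Z ω))
    (hshift : ∀ h : Fin d → ℝ, (exponentMeasure P fun ω t => Z ω (t + h)).restrict {f | 1 < f 0} =
      (exponentMeasure P Z).restrict {f | 1 < f 0})
    (hμ : ∀ᵐ t ∂μ, μ.map (· + t) = μ) (hA : MeasurableSet A) {ψ : ℝ≥0∞ → ℝ≥0∞}
    (hψ : Measurable ψ) :
    ∫⁻ f, ψ (excursion μ A f) * excursion μ A f ∂(exponentMeasure P Z) =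
      ∫⁻ t in A, (∫⁻ f in {f | 1 < f 0}, ψ (excursion μ ((· + t) ⁻¹' A) f)
        ∂(exponentMeasure P Z)) ∂μ := by
  have hE := measurable_excursion (μ := μ) hA
  let D : Set (((Fin d → ℝ) → ℝ) × (Fin d → ℝ)) := {q | 1 < upperLimit q.1 q.2}
  let I : ((Fin d → ℝ) → ℝ) × (Fin d → ℝ) → ℝ≥0∞ := D.indicator 1
  let K : ((Fin d → ℝ) → ℝ) → (Fin d → ℝ) → ℝ≥0∞ := fun f t => ψ (excursion μ A f) * I (f, t)
  have hind : Measurable I := measurable_one.indicator measurableSet_one_lt_upperLimit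
  have hK : Measurable (Function.uncurry K) :=
    ((hψ.comp hE).comp measurable_fst).mul hind
  have h1 : ∀ f, ψ (excursion μ A f) * excursion μ A f = ∫⁻ t in A, K f t ∂μ := by
    intro f
    have hms : MeasurableSet {t | 1 < upperLimit f t} :=
      measurable_prodMk_left measurableSet_one_lt_upperLimit
    have hI : ∀ t, I (f, t) = {t | 1 < upperLimit f t}.indicator 1 t := fun t => rfl
    simp only [K, hI]
    rw [lintegral_const_mul _ (measurable_one.indicator hms), lintegral_indicator_one hms,
      Measure.restrict_apply hms, inter_comm]
    rfl
  simp_rw [h1]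
  refine (lintegral_lintegral_swap hK.aemeasurable).trans (lintegral_congr_ae ?_)
  filter_upwards [ae_restrict_of_ae hμ] with t ht
  have hKt : Measurable fun f => K f t := (hψ.comp hE).mul (hind.comp measurable_prodMk_right)
  have hAt : MeasurableSet ((· + t) ⁻¹' A) := measurable_add_const t hA
  have hZt : Measurable fun ω u => Z ω (u + t) :=
    measurable_pi_lambda _ fun u => (measurable_pi_apply _).comp hZm
  have hEt : Measurable fun f => ψ (excursion μ ((· + t) ⁻¹' A) f) :=
    hψ.comp (measurable_excursion hAt)
  rw [← hshift t, ← lintegral_indicator measurableSet_one_lt_zero,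
    lintegral_exponentMeasure hZm hKt,
    lintegral_exponentMeasure hZt (hEt.indicator measurableSet_one_lt_zero)]
  refine lintegral_congr fun s => lintegral_congr_ae ?_
  filter_upwards [hZc] with ω hω
  have hc := hω.div_const s
  have hD : (fun u => Z ω u / s, t) ∈ D ↔ 1 < Z ω t / s := by
    simp only [D, mem_ofPred, hc.upperLimit_eq, ENNReal.one_lt_ofReal]
  have h0 : (fun u => Z ω (u + t) / s) ∈ {f : (Fin d → ℝ) → ℝ | 1 < f 0} ↔ 1 < Z ω t / s := by
    simp only [mem_ofPred, zero_add]
  by_cases h : 1 < Z ω t / s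
  · have hx := hc.excursion_comp_add hA ht
    rw [indicator_of_mem (h0.2 h)]
    simp only [K, I]
    rw [indicator_of_mem (hD.2 h), Pi.one_apply, mul_one, hx]
  · rw [indicator_of_notMem (mt h0.1 h)]
    simp only [K, I]
    rw [indicator_of_notMem (mt hD.1 h), mul_zero]

theorem bermanBox_eq {δ : ℝ} [SFinite (latticeMeasure d δ)] (hZm : Measurable Z)
    (hZc : ∀ᵐ ω ∂P, UpperContinuous (Z ω)) (x T : ℝ) :
    bermanBox P Z δ x T = exponentMeasure P Z
      {f | ENNReal.ofReal x < excursion (latticeMeasure d δ) (Icc 0 fun _ => T) f} := by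
  rw [exponentMeasure_apply hZm
    (measurableSet_lt measurable_const (measurable_excursion measurableSet_Icc))]
  refine setLIntegral_congr_fun measurableSet_Ioi fun s hs => ?_
  have hs : (0 : ℝ) < s := hs
  refine measure_congr ?_
  filter_upwards [hZc] with ω hω
  refine propext ?_
  change _ < _ ↔ _ < _
  rw [(hω.div_const s).excursion_eq]
  simp only [one_lt_div hs]
  rfl

end massTransport

/-! ### Invariance and box asymptotics of λ_δ -/

section lattice

variable {d : ℕ} {δ : ℝ}

/-- The embedding of `ℤ^d` as the lattice `δℤ^d`. -/
def latticePoint (d : ℕ) (δ : ℝ) (k : Fin d → ℤ) : Fin d → ℝ := fun i => δ * k i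

theorem latticePoint_injective (hδ : 0 < δ) : Function.Injective (latticePoint d δ) := by
  intro k l h
  ext i
  have := congrFun h i
  simpa [latticePoint, hδ.ne'] using this

theorem latticePoint_add (k l : Fin d → ℤ) :
    latticePoint d δ (k + l) = latticePoint d δ k + latticePoint d δ l := by
  ext i; simp [latticePoint, mul_add]

theorem measurable_latticePoint : Measurable (latticePoint d δ) := measurable_of_countable _

theorem range_latticePoint : range (latticePoint d δ) = lattice d δ := by
  ext t
  constructor
  · rintro ⟨k, rfl⟩ i
    exact ⟨k i, rfl⟩
  · intro h
    choose k hk using h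
    exact ⟨k, funext fun i => (hk i).symm⟩

theorem count_map_latticePoint (hδ : 0 < δ) :
    (Measure.count : Measure (Fin d → ℤ)).map (latticePoint d δ) =
      Measure.count.restrict (lattice d δ) := by
  have hL : MeasurableSet (lattice d δ) := by
    rw [← range_latticePoint]; exact (countable_range _).measurableSet
  refine Measure.ext fun S hS => ?_
  rw [Measure.map_apply measurable_latticePoint hS, Measure.restrict_apply hS,
    Measure.count_apply (measurable_latticePoint hS), Measure.count_apply (hS.inter hL),
    ← range_latticePoint, ← image_preimage_eq_inter_range, (latticePoint_injective hδ).encard_image]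

theorem latticeMeasure_of_pos (hδ : 0 < δ) : latticeMeasure d δ =
    ENNReal.ofReal (δ ^ d) • (Measure.count : Measure (Fin d → ℤ)).map (latticePoint d δ) := by
  rw [count_map_latticePoint hδ, latticeMeasure, if_neg hδ.ne']

theorem latticeMeasure_zero : latticeMeasure d 0 = volume := if_pos rfl

theorem sFinite_latticeMeasure (hδ : 0 ≤ δ) : SFinite (latticeMeasure d δ) := by
  rcases hδ.eq_or_lt with rfl | h
  · rw [latticeMeasure_zero]; infer_instance
  · rw [latticeMeasure_of_pos h]; infer_instance

theorem count_map_add_right (k : Fin d → ℤ) :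
    (Measure.count : Measure (Fin d → ℤ)).map (· + k) = Measure.count := by
  refine Measure.ext fun S hS => ?_
  rw [Measure.map_apply (measurable_of_countable _) hS,
    Measure.count_apply (measurable_of_countable _ hS), Measure.count_apply hS]
  have := (Equiv.addRight k).symm.injective.encard_image S
  rw [Equiv.image_symm_eq_preimage] at this
  rw [← this]
  rfl

theorem ae_latticeMeasure_map_add (hδ : 0 ≤ δ) :
    ∀ᵐ t ∂(latticeMeasure d δ), (latticeMeasure d δ).map (· + t) = latticeMeasure d δ := by
  rcases hδ.eq_or_lt with rfl | h
  · rw [latticeMeasure_zero]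
    exact ae_of_all _ fun t => (measurePreserving_add_right volume t).map_eq
  · have hL : MeasurableSet (lattice d δ) := by
      rw [← range_latticePoint]; exact (countable_range _).measurableSet
    have hmem : ∀ᵐ t ∂(latticeMeasure d δ), t ∈ lattice d δ := by
      rw [latticeMeasure, if_neg h.ne']
      exact Measure.ae_smul_measure (ae_restrict_mem hL) _
    filter_upwards [hmem] with t ht
    rw [← range_latticePoint] at ht
    obtain ⟨k, rfl⟩ := ht
    rw [latticeMeasure_of_pos h, Measure.map_smul,
      Measure.map_map (measurable_add_const _) measurable_latticePoint]
    conv_rhs => rw [← count_map_add_right k,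
      Measure.map_map measurable_latticePoint (measurable_of_countable _)]
    congr 2
    ext l : 1
    simp [latticePoint_add]

theorem le_latticeMeasure (hδ : 0 < δ) {S : Set (Fin d → ℝ)} (hS : MeasurableSet S)
    (h : latticeMeasure d δ S ≠ 0) : ENNReal.ofReal (δ ^ d) ≤ latticeMeasure d δ S := by
  rw [latticeMeasure_of_pos hδ, Measure.smul_apply, smul_eq_mul,
    Measure.map_apply measurable_latticePoint hS,
    Measure.count_apply (measurable_latticePoint hS)] at h ⊢
  have h1 : (1 : ℝ≥0∞) ≤ ((latticePoint d δ ⁻¹' S).encard : ℝ≥0∞) := by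
    have h2 : (latticePoint d δ ⁻¹' S).encard ≠ 0 := by
      rintro h3
      simp [h3] at h
    exact_mod_cast Order.one_le_iff_ne_zero.2 h2
  exact le_mul_of_one_le_right' h1

/-- The box is a product of d equal factors; l is the one-dimensional mass, which differs from the
side length by at most δ when a ≤ b. -/
theorem latticeMeasure_Icc (d : ℕ) (hδ : 0 ≤ δ) (a b : ℝ) :
    ∃ l : ℝ≥0∞, latticeMeasure d δ (Icc (fun _ => a) fun _ => b) = l ^ d ∧
      l ≤ ENNReal.ofReal (b - a + δ) ∧ ENNReal.ofReal (b - a - δ) ≤ l := by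
  rcases hδ.eq_or_lt with rfl | h
  · refine ⟨ENNReal.ofReal (b - a), ?_, by simp, by simp⟩
    rw [latticeMeasure_zero, Real.volume_Icc_pi]
    simp
  · have hpre : latticePoint d δ ⁻¹' (Icc (fun _ => a) fun _ => b) =
        ((Finset.Icc (fun _ => ⌈a / δ⌉) (fun _ => ⌊b / δ⌋) : Finset (Fin d → ℤ)) : Set (Fin d → ℤ)) := by
      ext k
      simp only [mem_preimage, mem_Icc, Finset.coe_Icc, Pi.le_def, latticePoint, Int.ceil_le,
        Int.le_floor, div_le_iff₀ h, le_div_iff₀ h, mul_comm]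
    have hr0 : b / δ - 1 < (⌊b / δ⌋ : ℝ) := Int.sub_one_lt_floor _
    have hr1 : (⌊b / δ⌋ : ℝ) ≤ b / δ := Int.floor_le _
    have hr2 : (⌈a / δ⌉ : ℝ) < a / δ + 1 := Int.ceil_lt_add_one _
    have hr3 : a / δ ≤ (⌈a / δ⌉ : ℝ) := Int.le_ceil _
    refine ⟨ENNReal.ofReal δ * ((⌊b / δ⌋ + 1 - ⌈a / δ⌉).toNat : ℝ≥0∞), ?_, ?_, ?_⟩
    · rw [latticeMeasure_of_pos h, Measure.smul_apply, smul_eq_mul,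
        Measure.map_apply measurable_latticePoint measurableSet_Icc, hpre,
        Measure.count_apply_finset, Pi.card_Icc, mul_pow, ENNReal.ofReal_pow h.le]
      simp
    · rw [← ENNReal.ofReal_natCast, ← ENNReal.ofReal_mul h.le]
      have hcast : (((⌊b / δ⌋ + 1 - ⌈a / δ⌉).toNat : ℤ) : ℝ) =
          max (((⌊b / δ⌋ + 1 - ⌈a / δ⌉ : ℤ) : ℝ)) 0 := by
        rw [Int.ofNat_toNat, Int.cast_max, Int.cast_zero]
      rw [Int.cast_natCast] at hcast
      rw [hcast]
      push_cast
      rcases le_total ((⌊b / δ⌋ : ℝ) + 1 - ⌈a / δ⌉) 0 with h0 | h0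
      · rw [max_eq_right h0, mul_zero, ENNReal.ofReal_zero]; exact zero_le
      · rw [max_eq_left h0]
        refine ENNReal.ofReal_le_ofReal ?_
        calc δ * ((⌊b / δ⌋ : ℝ) + 1 - ⌈a / δ⌉) ≤ δ * (b / δ + 1 - a / δ) := by gcongr
          _ = b - a + δ := by field_simp; ring
    · rw [← ENNReal.ofReal_natCast, ← ENNReal.ofReal_mul h.le]
      refine ENNReal.ofReal_le_ofReal ?_
      have hcast : ((⌊b / δ⌋ + 1 - ⌈a / δ⌉ : ℤ) : ℝ) ≤ ((⌊b / δ⌋ + 1 - ⌈a / δ⌉).toNat : ℝ) := by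
        exact_mod_cast Int.self_le_toNat _
      push_cast at hcast
      calc b - a - δ = δ * ((b / δ - 1) + 1 - (a / δ + 1)) := by field_simp; ring
        _ ≤ δ * ((⌊b / δ⌋ : ℝ) + 1 - ⌈a / δ⌉) := by gcongr
        _ ≤ _ := by gcongr

theorem latticeMeasure_Icc_lt_top (hδ : 0 ≤ δ) (a b : ℝ) :
    latticeMeasure d δ (Icc (fun _ => a) fun _ => b) < ∞ := by
  obtain ⟨l, h1, h2, -⟩ := latticeMeasure_Icc d hδ a b
  rw [h1]
  exact ENNReal.pow_lt_top (h2.trans_lt ENNReal.ofReal_lt_top)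

theorem tendsto_latticeMeasure_Icc (hδ : 0 ≤ δ) (r : ℝ) :
    Tendsto (fun T : ℝ => latticeMeasure d δ (Icc (fun _ => r) fun _ => T - r) /
      ENNReal.ofReal (T ^ d)) atTop (𝓝 1) := by
  choose l h1 h2 h3 using fun T : ℝ => latticeMeasure_Icc d hδ r (T - r)
  have hlin : ∀ c : ℝ, Tendsto (fun T : ℝ => ENNReal.ofReal (T + c) / ENNReal.ofReal T) atTop
      (𝓝 1) := by
    intro c
    have h : Tendsto (fun T : ℝ => 1 + c / T) atTop (𝓝 (1 + 0)) :=
      tendsto_const_nhds.add (tendsto_const_nhds.div_atTop tendsto_id)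
    rw [add_zero] at h
    have h' := ENNReal.tendsto_ofReal h
    rw [ENNReal.ofReal_one] at h'
    refine h'.congr' ?_
    filter_upwards [eventually_gt_atTop (0 : ℝ)] with T hT
    rw [← ENNReal.ofReal_div_of_pos hT]
    congr 1
    field_simp
  have hl : Tendsto (fun T : ℝ => l T / ENNReal.ofReal T) atTop (𝓝 1) := by
    refine tendsto_of_tendsto_of_tendsto_of_le_of_le (hlin (-2 * r - δ)) (hlin (-2 * r + δ))
      (fun T => ?_) fun T => ?_
    · refine ENNReal.div_le_div_right (le_trans (le_of_eq ?_) (h3 T)) _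
      congr 1; ring
    · refine ENNReal.div_le_div_right ((h2 T).trans (le_of_eq ?_)) _
      congr 1; ring
  have hp := ENNReal.Tendsto.pow (n := d) hl
  rw [one_pow] at hp
  refine hp.congr' ?_
  filter_upwards [eventually_gt_atTop (0 : ℝ)] with T hT
  rw [h1, ENNReal.ofReal_pow hT.le, div_eq_mul_inv, mul_pow, ← ENNReal.inv_pow, ← div_eq_mul_inv]

end lattice

/-! ### The truncated inverse l ↦ 𝟙(l > x)/l -/

/-- The function `l ↦ 𝟙(l > x) / l`. -/
noncomputable def truncInv (x l : ℝ≥0∞) : ℝ≥0∞ := (if x < l then 1 else 0) / l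

theorem measurable_truncInv (x : ℝ≥0∞) : Measurable (truncInv x) :=
  (Measurable.ite measurableSet_Ioi measurable_const measurable_const).div measurable_id

/-- At l = ∞ the product would be 0 · ∞ = 0; this is why the identity is used on boxes of finite
measure. -/
theorem truncInv_mul {x l : ℝ≥0∞} (hl : l ≠ ∞) : truncInv x l * l = if x < l then 1 else 0 := by
  rw [truncInv]
  split_ifs with h
  · exact ENNReal.div_mul_cancel (pos_of_gt h).ne' hl
  · simp

theorem truncInv_le_inv (x l : ℝ≥0∞) : truncInv x l ≤ x⁻¹ := by
  rw [truncInv]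
  split_ifs with h
  · rw [one_div]; exact ENNReal.inv_le_inv.2 h.le
  · simp

theorem iUnion_Icc_neg (d : ℕ) :
    ⋃ r : ℕ, Icc (fun _ : Fin d => -(r : ℝ)) (fun _ => (r : ℝ)) = univ := by
  refine eq_univ_of_forall fun t => mem_iUnion.2 ?_
  obtain ⟨r, hr⟩ := exists_nat_ge ‖t‖
  refine ⟨r, fun i => ?_, fun i => ?_⟩
  · exact (abs_le.1 ((norm_le_pi_norm t i).trans hr)).1
  · exact (abs_le.1 ((norm_le_pi_norm t i).trans hr)).2

/-! ### Averages over growing boxes -/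

section limit

variable {d : ℕ} {μ : Measure (Fin d → ℝ)}

theorem tendsto_excursion (f : (Fin d → ℝ) → ℝ) :
    Tendsto (fun r : ℕ => excursion μ (Icc (fun _ => -(r : ℝ)) fun _ => (r : ℝ)) f) atTop
      (𝓝 (excursion μ univ f)) := by
  have hset : {t | t ∈ (univ : Set (Fin d → ℝ)) ∧ 1 < upperLimit f t} =
      ⋃ r : ℕ, {t | t ∈ Icc (fun _ => -(r : ℝ)) (fun _ => (r : ℝ)) ∧ 1 < upperLimit f t} := by
    rw [← iUnion_Icc_neg d]
    ext t
    simp only [mem_ofPred, mem_iUnion, exists_and_right]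
  rw [excursion, hset]
  refine tendsto_measure_iUnion_atTop fun a b hab t ht => ⟨?_, ht.2⟩
  have hab' : (a : ℝ) ≤ b := by exact_mod_cast hab
  exact Icc_subset_Icc (fun _ => neg_le_neg hab') (fun _ => hab') ht.1

variable [SFinite μ] {ν : Measure ((Fin d → ℝ) → ℝ)} [IsFiniteMeasure ν] {x : ℝ≥0∞}

/-- `truncInv` is not monotone, so numerator and denominator are bounded separately. The lower bound
takes the small box in the numerator and the whole space in the denominator. -/
theorem tendsto_lintegral_truncInv_lower (hx : x ≠ 0) :
    Tendsto (fun r : ℕ => ∫⁻ f, (if x < excursion μ (Icc (fun _ => -(r : ℝ)) fun _ => (r : ℝ)) f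
      then 1 else 0) / excursion μ univ f ∂ν) atTop
      (𝓝 (∫⁻ f, truncInv x (excursion μ univ f) ∂ν)) := by
  have hm : ∀ r : ℕ, Measurable (excursion μ (Icc (fun _ : Fin d => -(r : ℝ)) fun _ => (r : ℝ))) :=
    fun r => measurable_excursion measurableSet_Icc
  have hmu : Measurable (excursion μ (univ : Set (Fin d → ℝ))) :=
    measurable_excursion MeasurableSet.univ
  refine tendsto_lintegral_of_dominated_convergence (fun _ => x⁻¹) (fun r => ?_) (fun r => ?_) ?_ ?_
  · exact (Measurable.ite (measurableSet_lt measurable_const (hm r)) measurable_const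
      measurable_const).div hmu
  · refine ae_of_all _ fun f => ?_
    dsimp only
    split_ifs with h
    · rw [one_div]
      exact ENNReal.inv_le_inv.2 (h.le.trans (excursion_mono (subset_univ _) f))
    · simp
  · rw [lintegral_const]
    exact ENNReal.mul_ne_top (ENNReal.inv_ne_top.2 hx) (measure_ne_top _ _)
  · refine ae_of_all _ fun f => ?_
    refine tendsto_const_nhds.congr' ?_
    by_cases h : x < excursion μ univ f
    · filter_upwards [(tendsto_excursion f).eventually (lt_mem_nhds h)] with r hr
      rw [truncInv, if_pos h, if_pos hr]
    · refine Eventually.of_forall fun r => ?_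
      have h' : ¬ x < excursion μ (Icc (fun _ => -(r : ℝ)) fun _ => (r : ℝ)) f :=
        fun h' => h (h'.trans_le (excursion_mono (subset_univ _) f))
      simp only [truncInv, if_neg h, if_neg h']

/-- Companion upper bound. The maximum with x costs nothing where the indicator of the bounded
quantity is 1, and it keeps the integrand below 1/x. -/
theorem tendsto_lintegral_truncInv_upper (hx : x ≠ 0) :
    Tendsto (fun r : ℕ => ∫⁻ f, (if x < excursion μ univ f then 1 else 0) /
      max (excursion μ (Icc (fun _ => -(r : ℝ)) fun _ => (r : ℝ)) f) x ∂ν) atTop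
      (𝓝 (∫⁻ f, truncInv x (excursion μ univ f) ∂ν)) := by
  have hm : ∀ r : ℕ, Measurable (excursion μ (Icc (fun _ : Fin d => -(r : ℝ)) fun _ => (r : ℝ))) :=
    fun r => measurable_excursion measurableSet_Icc
  have hmu : Measurable (excursion μ (univ : Set (Fin d → ℝ))) :=
    measurable_excursion MeasurableSet.univ
  refine tendsto_lintegral_of_dominated_convergence (fun _ => x⁻¹) (fun r => ?_) (fun r => ?_) ?_ ?_
  · exact (Measurable.ite (measurableSet_lt measurable_const hmu) measurable_const
      measurable_const).div ((hm r).max measurable_const)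
  · refine ae_of_all _ fun f => ?_
    dsimp only
    split_ifs with h
    · rw [one_div]
      exact ENNReal.inv_le_inv.2 (le_max_right _ _)
    · simp
  · rw [lintegral_const]
    exact ENNReal.mul_ne_top (ENNReal.inv_ne_top.2 hx) (measure_ne_top _ _)
  · refine ae_of_all _ fun f => ?_
    by_cases h : x < excursion μ univ f
    · simp only [truncInv, if_pos h, one_div]
      have := (tendsto_excursion (μ := μ) f).max (tendsto_const_nhds (x := x))
      rw [max_eq_left h.le] at this
      exact tendsto_inv_iff.2 this
    · simp only [truncInv, if_neg h, ENNReal.zero_div]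
      exact tendsto_const_nhds

/-- If t has distance at least r from the boundary of the box, then [-r, r]^d ⊆ A - t, and the two
sandwich bounds apply. The remaining t have proportion tending to 0. Let T → ∞ first, then r → ∞. -/
theorem tendsto_average_truncInv
    (hbox : ∀ a b : ℝ, μ (Icc (fun _ => a) fun _ => b) < ∞)
    (hlim : ∀ r : ℝ, Tendsto (fun T : ℝ => μ (Icc (fun _ => r) fun _ => T - r) /
      ENNReal.ofReal (T ^ d)) atTop (𝓝 1)) (hx : x ≠ 0) :
    Tendsto (fun T : ℝ => (∫⁻ t in Icc 0 fun _ => T,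
        (∫⁻ f, truncInv x (excursion μ ((· + t) ⁻¹' Icc 0 fun _ => T) f) ∂ν) ∂μ) /
        ENNReal.ofReal (T ^ d)) atTop
      (𝓝 (∫⁻ f, truncInv x (excursion μ univ f) ∂ν)) := by
  set F : ℝ → (Fin d → ℝ) → ℝ≥0∞ := fun T t =>
    ∫⁻ f, truncInv x (excursion μ ((· + t) ⁻¹' Icc 0 fun _ => T) f) ∂ν with hF
  have hsub : ∀ (r : ℕ) (T : ℝ) (t : Fin d → ℝ), t ∈ Icc (fun _ => (r : ℝ)) (fun _ => T - r) →
      Icc (fun _ => -(r : ℝ)) (fun _ => (r : ℝ)) ⊆ (· + t) ⁻¹' Icc 0 fun _ => T := by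
    intro r T t ht u hu
    refine ⟨fun i => ?_, fun i => ?_⟩
    · have := ht.1 i; have := hu.1 i
      simp only [Pi.zero_apply, Pi.add_apply] at *; linarith
    · have := ht.2 i; have := hu.2 i
      simp only [Pi.add_apply] at *; linarith
  have hCA : ∀ (r : ℕ) (T : ℝ), Icc (fun _ : Fin d => (r : ℝ)) (fun _ => T - r) ⊆
      Icc 0 fun _ => T := fun r T =>
    Icc_subset_Icc (fun _ => by simp) (fun _ => by simp)
  have hA : ∀ T : ℝ, Icc (0 : Fin d → ℝ) (fun _ => T) = Icc (fun _ => 0) fun _ => T - 0 := by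
    intro T; rw [sub_zero]; rfl
  refine tendsto_of_le_liminf_of_limsup_le ?_ ?_
  · refine le_of_tendsto' (tendsto_lintegral_truncInv_lower (μ := μ) (ν := ν) hx) fun r => ?_
    set l := ∫⁻ f, (if x < excursion μ (Icc (fun _ => -(r : ℝ)) fun _ => (r : ℝ)) f
      then 1 else 0) / excursion μ univ f ∂ν with hl
    have h1 : Tendsto (fun T : ℝ => μ (Icc (fun _ => (r : ℝ)) fun _ => T - r) /
        ENNReal.ofReal (T ^ d) * l) atTop (𝓝 (1 * l)) :=
      ENNReal.Tendsto.mul_const (hlim r) (Or.inl one_ne_zero)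
    rw [one_mul] at h1
    rw [← h1.liminf_eq]
    refine liminf_le_liminf (Eventually.of_forall fun T => ?_)
    rw [← ENNReal.mul_div_right_comm]
    refine ENNReal.div_le_div_right ?_ _
    calc μ (Icc (fun _ => (r : ℝ)) fun _ => T - r) * l
        = ∫⁻ _ in Icc (fun _ => (r : ℝ)) (fun _ => T - r), l ∂μ := by
          rw [setLIntegral_const, mul_comm]
      _ ≤ ∫⁻ t in Icc (fun _ => (r : ℝ)) (fun _ => T - r), F T t ∂μ := by
          refine setLIntegral_mono' measurableSet_Icc fun t ht => lintegral_mono fun f => ?_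
          have a1 := excursion_mono (μ := μ) (hsub r T t ht) f
          have a2 := excursion_mono (μ := μ) (subset_univ ((· + t) ⁻¹' Icc 0 fun _ => T)) f
          rw [truncInv]
          dsimp only
          split_ifs with b1 b2 b2
          · exact ENNReal.div_le_div_left a2 _
          · exact absurd (b1.trans_le a1) b2
          · simp
          · simp
      _ ≤ _ := lintegral_mono_set (hCA r T)
  · refine ge_of_tendsto' (tendsto_lintegral_truncInv_upper (μ := μ) (ν := ν) hx) fun r => ?_
    set u := ∫⁻ f, (if x < excursion μ univ f then 1 else 0) /
      max (excursion μ (Icc (fun _ => -(r : ℝ)) fun _ => (r : ℝ)) f) x ∂ν with hu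
    have hbd : ∀ T t, F T t ≤ x⁻¹ * ν univ := fun T t => by
      rw [← lintegral_const]
      exact lintegral_mono fun f => truncInv_le_inv _ _
    have hfin : x⁻¹ * ν univ ≠ ∞ :=
      ENNReal.mul_ne_top (ENNReal.inv_ne_top.2 hx) (measure_ne_top _ _)
    -- Bulk term plus boundary layer, the latter bounded by its proportion times the uniform bound
    -- x⁻¹ ν(univ).
    have h1 : Tendsto (fun T : ℝ => μ (Icc (fun _ => (r : ℝ)) fun _ => T - r) /
        ENNReal.ofReal (T ^ d) * u + (μ (Icc (fun _ => (0 : ℝ)) fun _ => T - 0) /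
        ENNReal.ofReal (T ^ d) - μ (Icc (fun _ => (r : ℝ)) fun _ => T - r) /
        ENNReal.ofReal (T ^ d)) * (x⁻¹ * ν univ)) atTop (𝓝 (1 * u + (1 - 1) * (x⁻¹ * ν univ))) :=
      (ENNReal.Tendsto.mul_const (hlim r) (Or.inl one_ne_zero)).add
        (ENNReal.Tendsto.mul_const (ENNReal.Tendsto.sub (hlim 0) (hlim r) (Or.inl ENNReal.one_ne_top))
          (Or.inr hfin))
    rw [one_mul, tsub_self, zero_mul, add_zero] at h1
    rw [← h1.limsup_eq]
    refine limsup_le_limsup ?_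
    filter_upwards [eventually_gt_atTop (0 : ℝ)] with T hT
    have hTd : ENNReal.ofReal (T ^ d) ≠ 0 := (ENNReal.ofReal_pos.2 (pow_pos hT d)).ne'
    rw [ENNReal.div_eq_inv_mul, ENNReal.div_eq_inv_mul, ENNReal.div_eq_inv_mul,
      ← ENNReal.mul_sub fun _ _ => ENNReal.inv_ne_top.2 hTd, mul_assoc, mul_assoc, ← mul_add]
    refine mul_le_mul_right ?_ _
    rw [← hA T, ← measure_sdiff (hCA r T) measurableSet_Icc.nullMeasurableSet (hbox _ _).ne,
      ← lintegral_inter_add_sdiff _ _ (measurableSet_Icc (a := fun _ : Fin d => (r : ℝ))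
        (b := fun _ => T - r)), inter_eq_right.2 (hCA r T)]
    refine add_le_add ?_ ?_
    · rw [mul_comm, ← setLIntegral_const]
      refine setLIntegral_mono' measurableSet_Icc fun t ht => lintegral_mono fun f => ?_
      have a1 := excursion_mono (μ := μ) (hsub r T t ht) f
      have a2 := excursion_mono (μ := μ) (subset_univ ((· + t) ⁻¹' Icc 0 fun _ => T)) f
      rw [truncInv]
      dsimp only
      split_ifs with b1 b2 b2
      · exact ENNReal.div_le_div_left (max_le a1 b1.le) _
      · exact absurd (b1.trans_le a2) b2
      · simp
      · simp
    · rw [mul_comm, ← setLIntegral_const]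
      exact lintegral_mono fun t => hbd T t

end limit

/-! ### The limit at positive levels x -/

section berman

variable {d : ℕ} {Ω : Type*} [MeasurableSpace Ω] {P : Measure Ω} [IsProbabilityMeasure P]
  {Z : Ω → (Fin d → ℝ) → ℝ} {δ : ℝ}

theorem measure_setOf_excursion_eq_lintegral {μ : Measure (Fin d → ℝ)} [SFinite μ]
    {A : Set (Fin d → ℝ)} (hA : MeasurableSet A) (hAf : μ A < ∞)
    (ν : Measure ((Fin d → ℝ) → ℝ)) (x : ℝ≥0∞) :
    ν {f | x < excursion μ A f} =
      ∫⁻ f, truncInv x (excursion μ A f) * excursion μ A f ∂ν := by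
  have hm : MeasurableSet {f | x < excursion μ A f} :=
    measurableSet_lt measurable_const (measurable_excursion hA)
  rw [← lintegral_indicator_one hm]
  refine lintegral_congr fun f => ?_
  rw [truncInv_mul ((excursion_le f).trans_lt hAf).ne]
  by_cases h : x < excursion μ A f
  · rw [if_pos h, indicator_of_mem (show f ∈ {f | x < excursion μ A f} from h), Pi.one_apply]
  · rw [if_neg h, indicator_of_notMem (show f ∉ {f | x < excursion μ A f} from h)]

theorem tendsto_exponentMeasure_excursion (hZm : Measurable Z)
    (hZc : ∀ᵐ ω ∂P, UpperContinuous (Z ω))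
    (hshift : ∀ h : Fin d → ℝ, (exponentMeasure P fun ω t => Z ω (t + h)).restrict {f | 1 < f 0} =
      (exponentMeasure P Z).restrict {f | 1 < f 0})
    [IsFiniteMeasure ((exponentMeasure P Z).restrict {f | 1 < f 0})]
    (hδ : 0 ≤ δ) {x : ℝ≥0∞} (hx : x ≠ 0) :
    Tendsto (fun T : ℝ => exponentMeasure P Z
        {f | x < excursion (latticeMeasure d δ) (Icc 0 fun _ => T) f} / ENNReal.ofReal (T ^ d)) atTop
      (𝓝 (∫⁻ f in {f | 1 < f 0}, truncInv x (excursion (latticeMeasure d δ) univ f)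
        ∂(exponentMeasure P Z))) := by
  have := sFinite_latticeMeasure (d := d) hδ
  have hlim := tendsto_average_truncInv (x := x)
    (ν := (exponentMeasure P Z).restrict {f | 1 < f 0}) (fun a b => latticeMeasure_Icc_lt_top hδ a b)
    (fun r => tendsto_latticeMeasure_Icc hδ r) hx
  have hA : ∀ T : ℝ, latticeMeasure d δ (Icc 0 fun _ => T) < ∞ := latticeMeasure_Icc_lt_top hδ 0
  refine hlim.congr fun T => ?_
  rw [measure_setOf_excursion_eq_lintegral measurableSet_Icc (hA T),
    lintegral_excursion_mul hZm hZc hshift (ae_latticeMeasure_map_add hδ) measurableSet_Icc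
      (measurable_truncInv x)]

end berman

/-! ### The limit at x = 0 for Lebesgue measure -/

section zeroLevel

variable {d : ℕ} {Ω : Type*} [MeasurableSpace Ω] {P : Measure Ω} [IsProbabilityMeasure P]
  {Z : Ω → (Fin d → ℝ) → ℝ} {A : Set (Fin d → ℝ)}

-- For a fixed path, an excursion above s inside A forces s below the supremum over A, so the
-- admissible s have total length at most that supremum.
omit [IsProbabilityMeasure P] in
theorem exponentMeasure_excursion_pos_le {μ : Measure (Fin d → ℝ)} [SFinite μ]
    (hZm : Measurable Z) (hZc : ∀ᵐ ω ∂P, UpperContinuous (Z ω)) (hA : MeasurableSet A) :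
    exponentMeasure P Z {f | 0 < excursion μ A f} ≤
      ∫⁻ ω, ⨆ t ∈ A, ENNReal.ofReal (Z ω t) ∂P := by
  have hm : MeasurableSet {f | 0 < excursion μ A f} :=
    measurableSet_lt measurable_const (measurable_excursion hA)
  rw [exponentMeasure, Measure.map_apply (measurable_div_field hZm) hm,
    Measure.prod_apply (measurable_div_field hZm hm)]
  refine lintegral_mono_ae ?_
  filter_upwards [hZc] with ω hω
  set S := ⨆ t ∈ A, ENNReal.ofReal (Z ω t) with hS
  rcases eq_or_ne S ∞ with h | h
  · rw [h]; exact le_top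
  rw [Measure.restrict_apply' measurableSet_Ioi]
  calc _ ≤ volume (Ioo 0 S.toReal) := by
        refine measure_mono ?_
        rintro s ⟨h1, h2⟩
        have h2 : 0 < s := h2
        have h1 : 0 < excursion μ A (fun t => Z ω t / s) := h1
        rw [(hω.div_const s).excursion_eq] at h1
        obtain ⟨t, ht, hts⟩ := nonempty_of_measure_ne_zero h1.ne'
        rw [one_lt_div h2] at hts
        refine ⟨h2, hts.trans_le ?_⟩
        rw [← ENNReal.ofReal_le_iff_le_toReal h]
        exact le_iSup₂ (f := fun t _ => ENNReal.ofReal (Z ω t)) t ht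
    _ = S := by rw [Real.volume_Ioo, sub_zero, ENNReal.ofReal_toReal h]

/-- Invariance is available only on {f(0) > 1}; the mass transport identity, applied to both sets,
reduces the claim to that event and to translation of the t-integral. -/
theorem exponentMeasure_excursion_translate (hZm : Measurable Z)
    (hZc : ∀ᵐ ω ∂P, UpperContinuous (Z ω))
    (hshift : ∀ h : Fin d → ℝ, (exponentMeasure P fun ω t => Z ω (t + h)).restrict {f | 1 < f 0} =
      (exponentMeasure P Z).restrict {f | 1 < f 0})
    (hA : MeasurableSet A) (hAf : volume A < ∞) (c : Fin d → ℝ) (x : ℝ≥0∞) :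
    exponentMeasure P Z {f | x < excursion volume ((· + c) ⁻¹' A) f} =
      exponentMeasure P Z {f | x < excursion volume A f} := by
  have hc : MeasurableSet ((· + c) ⁻¹' A) := measurable_add_const c hA
  have hinv : ∀ᵐ t : Fin d → ℝ, (volume : Measure (Fin d → ℝ)).map (· + t) = volume :=
    ae_of_all _ fun t => (measurePreserving_add_right volume t).map_eq
  have hcf : volume ((· + c) ⁻¹' A) < ∞ := by rwa [measure_preimage_add_right]
  rw [measure_setOf_excursion_eq_lintegral hA hAf, measure_setOf_excursion_eq_lintegral hc hcf,
    lintegral_excursion_mul hZm hZc hshift hinv hA (measurable_truncInv x),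
    lintegral_excursion_mul hZm hZc hshift hinv hc (measurable_truncInv x),
    ← lintegral_indicator hA, ← lintegral_indicator hc]
  rw [← lintegral_add_right_eq_self (A.indicator _) c]
  refine lintegral_congr fun t => ?_
  have e : (· + t) ⁻¹' ((· + c) ⁻¹' A) = (· + (t + c)) ⁻¹' A := by
    ext u; simp only [mem_preimage, add_assoc]
  by_cases h : t + c ∈ A
  · rw [indicator_of_mem h, indicator_of_mem (show t ∈ (· + c) ⁻¹' A from h), e]
  · rw [indicator_of_notMem h, indicator_of_notMem (show t ∉ (· + c) ⁻¹' A from h)]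

/-- A box of side `T ≥ 1` is covered by `(⌊T⌋ + 1)^d` unit cubes that it contains. -/
theorem exists_cover_unit_cubes {T : ℝ} (hT : 1 ≤ T) :
    ∃ c : (Fin d → Fin (⌊T⌋₊ + 1)) → Fin d → ℝ,
      (∀ k, (· + c k) ⁻¹' Icc (0 : Fin d → ℝ) (fun _ => 1) ⊆ Icc 0 fun _ => T) ∧
      Icc (0 : Fin d → ℝ) (fun _ => T) ⊆ ⋃ k, (· + c k) ⁻¹' Icc 0 fun _ => 1 := by
  -- Cube k starts at min(k, T - 1) in each coordinate, so the last cubes are pushed back inside the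
  -- box.
  refine ⟨fun k i => -min ((k i : ℕ) : ℝ) (T - 1), fun k t ht => ⟨fun i => ?_, fun i => ?_⟩,
    fun t ht => ?_⟩
  · have h := ht.1 i
    have : (0 : ℝ) ≤ min ((k i : ℕ) : ℝ) (T - 1) := le_min (Nat.cast_nonneg _) (by linarith)
    simp only [Pi.zero_apply, Pi.add_apply] at *
    linarith
  · have h := ht.2 i
    have : min ((k i : ℕ) : ℝ) (T - 1) ≤ T - 1 := min_le_right _ _
    simp only [Pi.add_apply] at *
    linarith
  · refine mem_iUnion.2 ⟨fun i => ⟨⌊t i⌋₊, ?_⟩, fun i => ?_, fun i => ?_⟩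
    · exact Nat.lt_succ_of_le (Nat.floor_le_floor (ht.2 i))
    · have h1 := Nat.floor_le (ht.1 i)
      have h2 : min (⌊t i⌋₊ : ℝ) (T - 1) ≤ ⌊t i⌋₊ := min_le_left _ _
      simp only [Pi.zero_apply, Pi.add_apply] at *
      linarith
    · have h1 := Nat.lt_floor_add_one (t i)
      have h3 := ht.2 i
      simp only [Pi.add_apply] at *
      rcases min_choice (⌊t i⌋₊ : ℝ) (T - 1) with h | h <;> rw [h] <;> linarith

theorem setOf_lt_excursion_subset {μ : Measure (Fin d → ℝ)} (η : ℝ≥0∞) :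
    {f | η < excursion μ A f} ⊆ {f | 0 < excursion μ A f} :=
  fun _ (hf : η < _) => zero_le.trans_lt hf

variable (hZm : Measurable Z) (hZc : ∀ᵐ ω ∂P, UpperContinuous (Z ω))
  (hshift : ∀ h : Fin d → ℝ, (exponentMeasure P fun ω t => Z ω (t + h)).restrict {f | 1 < f 0} =
    (exponentMeasure P Z).restrict {f | 1 < f 0})
  (hfin : exponentMeasure P Z {f | 0 < excursion volume (Icc 0 fun _ => 1) f} ≠ ∞)

include hZm hZc hshift hfin

/-- If 0 < E_A ≤ η, some covering cube C has E_C > 0, and E_C ≤ η because C ⊆ A. By translation, all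
cubes carry the same mass of such paths. -/
theorem exponentMeasure_excursion_pos_le_add {T : ℝ} (hT : 1 ≤ T) (η : ℝ≥0∞) :
    exponentMeasure P Z {f | 0 < excursion volume (Icc 0 fun _ => T) f} ≤
      exponentMeasure P Z {f | η < excursion volume (Icc 0 fun _ => T) f} +
      ((⌊T⌋₊ + 1 : ℕ) : ℝ≥0∞) ^ d *
        (exponentMeasure P Z {f | 0 < excursion volume (Icc 0 fun _ => 1) f} -
          exponentMeasure P Z {f | η < excursion volume (Icc 0 fun _ => 1) f}) := by
  obtain ⟨c, hc1, hc2⟩ := exists_cover_unit_cubes (d := d) hT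
  set C := Icc (0 : Fin d → ℝ) (fun _ => 1) with hC
  set A := Icc (0 : Fin d → ℝ) (fun _ => T) with hA
  have hCf : volume C < ∞ := measure_Icc_lt_top
  have hm : ∀ (B : Set (Fin d → ℝ)), MeasurableSet B → ∀ x : ℝ≥0∞,
      MeasurableSet {f | x < excursion volume B f} := fun B hB x =>
    measurableSet_lt measurable_const (measurable_excursion hB)
  have hsub : {f | 0 < excursion volume A f} ⊆ {f | η < excursion volume A f} ∪
      ⋃ k, ({f | 0 < excursion volume ((· + c k) ⁻¹' C) f} \
        {f | η < excursion volume ((· + c k) ⁻¹' C) f}) := by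
    intro f hf
    by_cases h : η < excursion volume A f
    · exact Or.inl h
    · right
      by_contra hcon
      simp only [mem_iUnion, Set.mem_sdiff, mem_ofPred, not_exists, not_and, not_not] at hcon
      have hz : ∀ k, excursion volume ((· + c k) ⁻¹' C) f = 0 := fun k => by
        by_contra hk
        exact h ((hcon k (pos_iff_ne_zero.2 hk)).trans_le (excursion_mono (hc1 k) f))
      refine (show 0 < excursion volume A f from hf).ne' ?_
      refine measure_mono_null ?_ (measure_iUnion_null hz)
      rintro t ⟨h1, h2⟩
      obtain ⟨k, hk⟩ := mem_iUnion.1 (hc2 h1)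
      exact mem_iUnion.2 ⟨k, hk, h2⟩
  refine (measure_mono hsub).trans ((measure_union_le _ _).trans ?_)
  gcongr
  refine (measure_iUnion_le _).trans ?_
  rw [tsum_fintype]
  refine (Finset.sum_le_card_nsmul _ _ (exponentMeasure P Z {f | 0 < excursion volume C f} -
    exponentMeasure P Z {f | η < excursion volume C f}) fun k _ => ?_).trans (le_of_eq ?_)
  · have hk : MeasurableSet ((· + c k) ⁻¹' C) := measurable_add_const _ measurableSet_Icc
    have ht := exponentMeasure_excursion_translate hZm hZc hshift
      (measurableSet_Icc (a := (0 : Fin d → ℝ)) (b := fun _ => 1)) hCf (c k)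
    rw [measure_sdiff _ (hm _ hk _).nullMeasurableSet, ht 0, ht η]
    · rw [ht η]
      exact ne_top_of_le_ne_top hfin (measure_mono (setOf_lt_excursion_subset η))
    · exact setOf_lt_excursion_subset η
  · simp

/-- The level 0 is approximated by levels η ↓ 0. The normalised error is at most 2^d κ(η) uniformly
in T ≥ 1, because ⌊T⌋ + 1 ≤ 2T, and κ(η) → 0 by continuity of measure. -/
theorem tendsto_exponentMeasure_excursion_pos
    [IsFiniteMeasure ((exponentMeasure P Z).restrict {f | 1 < f 0})] :
    Tendsto (fun T : ℝ => exponentMeasure P Z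
        {f | 0 < excursion volume (Icc 0 fun _ => T) f} / ENNReal.ofReal (T ^ d)) atTop
      (𝓝 (∫⁻ f in {f | 1 < f 0}, truncInv 0 (excursion volume univ f)
        ∂(exponentMeasure P Z))) ∧
    ∫⁻ f in {f | 1 < f 0}, truncInv 0 (excursion volume univ f) ∂(exponentMeasure P Z) < ∞ := by
  set C := Icc (0 : Fin d → ℝ) (fun _ => 1) with hC
  set κ : ℝ≥0∞ → ℝ≥0∞ := fun η => exponentMeasure P Z {f | 0 < excursion volume C f} -
    exponentMeasure P Z {f | η < excursion volume C f} with hκ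
  set b : ℝ≥0∞ → ℝ≥0∞ := fun η => ∫⁻ f in {f | 1 < f 0}, truncInv η (excursion volume univ f)
    ∂(exponentMeasure P Z) with hb
  set β : ℝ≥0∞ → ℝ → ℝ≥0∞ := fun η T => exponentMeasure P Z
    {f | η < excursion volume (Icc 0 fun _ => T) f} / ENNReal.ofReal (T ^ d) with hβ
  have hlim : ∀ η, η ≠ 0 → Tendsto (β η) atTop (𝓝 (b η)) := fun η hη => by
    have := tendsto_exponentMeasure_excursion hZm hZc hshift (le_refl (0 : ℝ)) hη
    rwa [latticeMeasure_zero] at this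
  have hle : ∀ η, ∀ᶠ T in atTop, β 0 T ≤ β η T + 2 ^ d * κ η := by
    intro η
    filter_upwards [eventually_ge_atTop (1 : ℝ)] with T hT
    have h1 := exponentMeasure_excursion_pos_le_add hZm hZc hshift hfin hT η
    have hT0 : 0 < T := one_pos.trans_le hT
    have hTd : ENNReal.ofReal (T ^ d) ≠ 0 := (ENNReal.ofReal_pos.2 (pow_pos hT0 d)).ne'
    refine (ENNReal.div_le_div_right h1 _).trans ?_
    rw [ENNReal.add_div]
    gcongr
    refine ENNReal.div_le_of_le_mul ?_
    rw [mul_right_comm, ENNReal.ofReal_pow hT0.le, ← mul_pow]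
    gcongr
    rw [← ENNReal.ofReal_natCast, show (2 : ℝ≥0∞) = ENNReal.ofReal 2 by simp,
      ← ENNReal.ofReal_mul (by norm_num)]
    refine ENNReal.ofReal_le_ofReal ?_
    have := Nat.floor_le hT0.le
    push_cast
    linarith
  let η : ℕ → ℝ≥0∞ := fun n => (((n : ℝ≥0∞)) + 1)⁻¹
  have hη0 : ∀ n, η n ≠ 0 := fun n => ENNReal.inv_ne_zero.2 (by finiteness)
  have hηa : Antitone η := fun m n h => ENNReal.inv_le_inv.2 (by gcongr)
  have hηl : Tendsto η atTop (𝓝 0) := by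
    have h1 : Tendsto (fun n : ℕ => ((n + 1 : ℕ) : ℝ≥0∞)⁻¹) atTop (𝓝 0) :=
      ENNReal.tendsto_inv_nat_nhds_zero.comp (tendsto_add_atTop_nat 1)
    simpa [η] using h1
  have hmu : Measurable (excursion volume (univ : Set (Fin d → ℝ))) :=
    measurable_excursion MeasurableSet.univ
  have hbl : Tendsto (fun n => b (η n)) atTop (𝓝 (b 0)) := by
    refine lintegral_tendsto_of_tendsto_of_monotone
      (fun n => ((measurable_truncInv _).comp hmu).aemeasurable) (ae_of_all _ fun f m n h => ?_)
      (ae_of_all _ fun f => ?_)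
    · simp only [truncInv]
      split_ifs with h1 h2 h2
      · exact le_rfl
      · exact absurd ((hηa h).trans_lt h1) h2
      · exact ENNReal.div_le_div_right zero_le _
      · exact le_rfl
    · rcases eq_or_ne (excursion volume univ f) 0 with h | h
      · simp [truncInv, h]
      · have h' := pos_iff_ne_zero.2 h
        refine tendsto_const_nhds.congr' ?_
        filter_upwards [hηl.eventually (gt_mem_nhds h')] with n hn
        rw [truncInv, truncInv, if_pos h', if_pos hn]
  have hκl : Tendsto (fun n => κ (η n)) atTop (𝓝 0) := by
    have hset : {f | 0 < excursion volume C f} = ⋃ n, {f | η n < excursion volume C f} := by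
      ext f
      simp only [mem_ofPred, mem_iUnion]
      exact ⟨fun h => (hηl.eventually (gt_mem_nhds h)).exists, fun ⟨n, h⟩ => pos_of_gt h⟩
    have h1 : Tendsto (fun n => exponentMeasure P Z {f | η n < excursion volume C f}) atTop
        (𝓝 (exponentMeasure P Z {f | 0 < excursion volume C f})) := by
      rw [hset]
      exact tendsto_measure_iUnion_atTop fun m n h f hf => (hηa h).trans_lt hf
    have h2 := ENNReal.Tendsto.sub (tendsto_const_nhds
      (x := exponentMeasure P Z {f | 0 < excursion volume C f})) h1 (Or.inl hfin)
    rwa [tsub_self] at h2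
  have hβ0 : ∀ η T, β η T ≤ β 0 T := fun η T =>
    ENNReal.div_le_div_right (measure_mono (setOf_lt_excursion_subset η)) _
  -- No sojourn exceeds ∞, so the covering bound at η = ∞ bounds β 0, and with it every β η, by a
  -- finite constant.
  have hb0 : b 0 ≤ 2 ^ d * κ ∞ := by
    refine le_of_tendsto' hbl fun n => le_of_tendsto (hlim _ (hη0 n)) ?_
    filter_upwards [hle ∞] with T hT
    refine (hβ0 _ T).trans (hT.trans_eq ?_)
    simp [hβ]
  refine ⟨tendsto_of_le_liminf_of_limsup_le ?_ ?_, hb0.trans_lt ?_⟩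
  · refine le_of_tendsto' hbl fun n => ?_
    rw [← (hlim _ (hη0 n)).liminf_eq]
    exact liminf_le_liminf (Eventually.of_forall fun T => hβ0 _ T)
  · have h1 : Tendsto (fun n => b (η n) + 2 ^ d * κ (η n)) atTop (𝓝 (b 0 + 2 ^ d * 0)) :=
      hbl.add (ENNReal.Tendsto.const_mul hκl (Or.inr (by finiteness)))
    rw [mul_zero, add_zero] at h1
    refine ge_of_tendsto' h1 fun n => ?_
    rw [← ((hlim _ (hη0 n)).add_const (2 ^ d * κ (η n))).limsup_eq]
    exact limsup_le_limsup (hle (η n))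
  · exact ENNReal.mul_lt_top (by finiteness) (tsub_le_self.trans_lt hfin.lt_top)

end zeroLevel

/-! ### All cases together -/

section main

variable {d : ℕ} {Ω Ω' : Type*} [MeasurableSpace Ω] [MeasurableSpace Ω']
  {P : Measure Ω} [IsProbabilityMeasure P] {Z : Ω → (Fin d → ℝ) → ℝ}

theorem restrict_exponentMeasure_shift (hZm : Measurable Z) (hZ0 : ∀ t, ∀ᵐ ω ∂P, 0 ≤ Z ω t)
    (hZ1 : ∀ t, ∫⁻ ω, ENNReal.ofReal (Z ω t) ∂P = 1)
    {P' : Measure Ω'} [IsProbabilityMeasure P'] {X : Ω' → (Fin d → ℝ) → ℝ}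
    (hX : IsSpectralField P Z P' X) (hXstat : IsStationaryField P' X) (h : Fin d → ℝ) :
    (exponentMeasure P fun ω t => Z ω (t + h)).restrict {f | 1 < f 0} =
      (exponentMeasure P Z).restrict {f | 1 < f 0} :=
  restrict_exponentMeasure_congr hZm hZ0 hZ1
    (measurable_pi_lambda _ fun t => (measurable_pi_apply (t + h)).comp hZm)
    (fun t => hZ0 (t + h)) (fun t => hZ1 (t + h))
    fun _ hJ => exponent_shift hZm hZ0 hZ1 hX hXstat hJ h

theorem tendsto_exponentMeasure_div_of_nonneg (hZm : Measurable Z)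
    (hZc : ∀ᵐ ω ∂P, UpperContinuous (Z ω))
    (hshift : ∀ h : Fin d → ℝ, (exponentMeasure P fun ω t => Z ω (t + h)).restrict {f | 1 < f 0} =
      (exponentMeasure P Z).restrict {f | 1 < f 0})
    (hsup : ∫⁻ ω, ⨆ t ∈ Icc (0 : Fin d → ℝ) (fun _ => 1), ENNReal.ofReal (Z ω t) ∂P ≠ ∞)
    [IsFiniteMeasure ((exponentMeasure P Z).restrict {f | 1 < f 0})]
    {δ : ℝ} (hδ : 0 ≤ δ) (x : ℝ≥0∞) :
    Tendsto (fun T : ℝ => exponentMeasure P Z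
        {f | x < excursion (latticeMeasure d δ) (Icc 0 fun _ => T) f} / ENNReal.ofReal (T ^ d)) atTop
      (𝓝 (∫⁻ f in {f | 1 < f 0}, truncInv x (excursion (latticeMeasure d δ) univ f)
        ∂(exponentMeasure P Z))) ∧
    ∫⁻ f in {f | 1 < f 0}, truncInv x (excursion (latticeMeasure d δ) univ f)
      ∂(exponentMeasure P Z) < ∞ := by
  have hpos : ∀ y : ℝ≥0∞, y ≠ 0 → ∫⁻ f in {f | 1 < f 0},
      truncInv y (excursion (latticeMeasure d δ) univ f) ∂(exponentMeasure P Z) < ∞ := by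
    intro y hy
    refine (lintegral_mono fun f => truncInv_le_inv y _).trans_lt ?_
    rw [lintegral_const]
    exact ENNReal.mul_lt_top (ENNReal.inv_ne_top.2 hy).lt_top (measure_lt_top _ _)
  rcases eq_or_ne x 0 with rfl | hx
  · rcases hδ.eq_or_lt with rfl | h
    · rw [latticeMeasure_zero]
      exact tendsto_exponentMeasure_excursion_pos hZm hZc hshift (ne_top_of_le_ne_top hsup
        (exponentMeasure_excursion_pos_le hZm hZc measurableSet_Icc))
    -- Lattice sojourns take no value strictly between 0 and δ^d, so exceeding 0 is the same as
    -- exceeding δ^d/2, and the case of a positive level applies.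
    · set y := ENNReal.ofReal (δ ^ d) / 2 with hy
      have hδd : ENNReal.ofReal (δ ^ d) ≠ 0 := (ENNReal.ofReal_pos.2 (pow_pos h d)).ne'
      have hy0 : y ≠ 0 := (ENNReal.half_pos hδd).ne'
      have hiff : ∀ A : Set (Fin d → ℝ), MeasurableSet A → ∀ f,
          0 < excursion (latticeMeasure d δ) A f ↔ y < excursion (latticeMeasure d δ) A f := by
        refine fun A hA f => ⟨fun hf => ?_, fun hf => zero_le.trans_lt hf⟩
        exact (ENNReal.half_lt_self hδd ENNReal.ofReal_ne_top).trans_le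
          (le_latticeMeasure h (measurableSet_excursion hA f) hf.ne')
      have h1 := tendsto_exponentMeasure_excursion hZm hZc hshift hδ hy0
      have h2 := hpos y hy0
      simp only [truncInv, ← hiff _ measurableSet_Icc, ← hiff _ MeasurableSet.univ] at h1 h2
      exact ⟨h1, h2⟩
  · exact ⟨tendsto_exponentMeasure_excursion hZm hZc hshift hδ hx, hpos x hx⟩

end main

end Berman

theorem mainTheorem2 {d : ℕ} (hd : 1 ≤ d)
    {Ω Ω' Ω'' : Type*} [MeasurableSpace Ω] [MeasurableSpace Ω'] [MeasurableSpace Ω'']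
    -- the random field `Z`
    (P : Measure Ω) [IsProbabilityMeasure P]
    (Z : Ω → (Fin d → ℝ) → ℝ) (hZm : Measurable Z)
    (hZD : ∀ᵐ ω ∂P, Z ω ∈ Berman.cadlagSpace d)
    (hZ1 : ∀ t, ∫⁻ ω, ENNReal.ofReal (Z ω t) ∂P = 1)
    (hZsup : ∀ T : ℝ, 0 < T →
      ∫⁻ ω, ⨆ t ∈ Icc (0 : Fin d → ℝ) (fun _ => T), ENNReal.ofReal (Z ω t) ∂P < ∞)
    (hZpos : ∀ᵐ ω ∂P, ∃ t, 0 < Z ω t)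
    -- the stationary max-stable random field `X` with spectral random field `Z`
    (P' : Measure Ω') [IsProbabilityMeasure P']
    (X : Ω' → (Fin d → ℝ) → ℝ) (hXm : Measurable X)
    (hX : Berman.IsSpectralField P Z P' X)
    (hXstat : Berman.IsStationaryField P' X)
    -- the tilted field `Θ` and an independent 1-Pareto variable `R`
    (Q : Measure Ω'') [IsProbabilityMeasure Q]
    (Θ : Ω'' → (Fin d → ℝ) → ℝ) (hΘm : Measurable Θ)
    (hΘD : ∀ᵐ ω ∂Q, Θ ω ∈ Berman.cadlagSpace d)
    (hΘ : Q.map Θ = Berman.tiltedLaw P Z)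
    (R : Ω'' → ℝ) (hRm : Measurable R) (hR : Q.map R = paretoMeasure 1 1)
    (hRΘ : IndepFun R Θ Q)
    (hS : P {ω | Berman.totalMass 0 (Z ω) = ∞} < 1)
    (δ x : ℝ) (hδ : 0 ≤ δ) (hx : 0 ≤ x) :
    Berman.HasBermanValue P Z δ x
      (∫⁻ ω, (if ENNReal.ofReal x < Berman.sojourn δ univ 1 (fun t => R ω * Θ ω t)
        then 1 else 0) / Berman.sojourn δ univ 1 (fun t => R ω * Θ ω t) ∂Q) ∧
    ∫⁻ ω, (if ENNReal.ofReal x < Berman.sojourn δ univ 1 (fun t => R ω * Θ ω t)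
        then 1 else 0) / Berman.sojourn δ univ 1 (fun t => R ω * Θ ω t) ∂Q < ∞ := by
  have hZc : ∀ᵐ ω ∂P, Berman.UpperContinuous (Z ω) :=
    hZD.mono fun ω hω => Berman.UpperContinuous.of_mem_cadlagSpace hω
  have hZ0 : ∀ t, ∀ᵐ ω ∂P, 0 ≤ Z ω t := fun t => hZD.mono fun ω hω => hω.1 t
  have hshift := Berman.restrict_exponentMeasure_shift hZm hZ0 hZ1 hX hXstat
  have hY := Berman.map_pareto_mul_tilted hZm hZ0 Q hΘm hΘ hRm hR hRΘ
  have hYm : Measurable fun ω t => R ω * Θ ω t :=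
    measurable_pi_lambda _ fun t => hRm.mul ((measurable_pi_apply t).comp hΘm)
  -- The restricted measure is the law of RΘ, hence a probability measure.
  have hfin : IsFiniteMeasure ((Berman.exponentMeasure P Z).restrict {f | 1 < f 0}) := by
    rw [← hY]; infer_instance
  have hsf := Berman.sFinite_latticeMeasure (d := d) hδ
  have hval : ∫⁻ ω, (if ENNReal.ofReal x < Berman.sojourn δ univ 1 (fun t => R ω * Θ ω t)
        then 1 else 0) / Berman.sojourn δ univ 1 (fun t => R ω * Θ ω t) ∂Q =
      ∫⁻ f in {f | 1 < f 0}, Berman.truncInv (ENNReal.ofReal x)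
        (Berman.excursion (Berman.latticeMeasure d δ) univ f) ∂(Berman.exponentMeasure P Z) := by
    have hF : Measurable fun f => Berman.truncInv (ENNReal.ofReal x)
        (Berman.excursion (Berman.latticeMeasure d δ) univ f) :=
      (Berman.measurable_truncInv _).comp (Berman.measurable_excursion MeasurableSet.univ)
    rw [← hY, lintegral_map hF hYm]
    refine lintegral_congr_ae ?_
    filter_upwards [hΘD] with ω hω
    rw [((Berman.UpperContinuous.of_mem_cadlagSpace hω).const_mul (R ω)).excursion_eq]
    rfl
  rw [hval]
  obtain ⟨h1, h2⟩ := Berman.tendsto_exponentMeasure_div_of_nonneg hZm hZc hshift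
    (hZsup 1 one_pos).ne hδ (ENNReal.ofReal x)
  refine ⟨?_, h2⟩
  simp only [Berman.HasBermanValue, Berman.bermanBox_eq hZm hZc]
  exact h1
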